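/- **Setting.** Let $M=\mathbb{R}^3$, $G,\gamma>0$, $b=8\pi G\gamma$. Let $\mathcal A$ (resp. $\mathcal A^{\mathbb C}$) be the space of smooth $\mathrm{SU}(2)$ (resp. $\mathrm{SL}(2,\mathbb C)$) connections $A^i_a$ on $M$, with components in the basis $\tau_i=-\tfrac i2\sigma_i$, and $\Gamma$ the set of pairs $(A^i_a,\tilde E^a_i)$ with $A\in\mathcal A$ and $\tilde E$ a smooth densitized triad. The Euclidean group acts on $\Gamma$ by motions $y\mapsto ry+v$ combined with the constant gauge rotation $r$; $\Gamma_S\subset\Gamma$ is the set of invariant pairs. Fix $\ell_o>0$, an invariant $\mathring A\in\mathcal A$, $\mathring A\ne0$, and the triad $\mathring e$ with $\mathring e^a_i\mathring A^j_a=\ell_o^{-1}\delta^j_i$, with metric $\mathring q$. A point of $\Gamma_S$ has coordinates $(c,p)\in\mathbb R^2$ with $A=c\mathring A$, $\tilde E=p\,\ell_o^{-2}\sqrt{\mathring q}\,\mathring e$. *Cylindrical functions.* $\underline{\mathrm{Cyl}}$ is the space of functions $\Phi(A)=F(A(e_1),\dots,A(e_n))$ on $\mathcal A$, where $e_1,\dots,e_n$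 are straight edges, $A(e)$ is the holonomy, and $F:\mathrm{SU}(2)^n\to\mathbb C$ is real analytic. With $r(c)=c\mathring A$, $\mathrm{Cyl}_S=r^*[\underline{\mathrm{Cyl}}]$, a space of functions on $\mathbb R$. A star denotes the algebraic dual. *Complexifiers.* Let $C=C[\tilde E]\ge0$ and $C_S=C_S(p)\ge 0$ be functions of the momenta only, where $\delta C/\delta\tilde E$ exists (as a smooth field, for compactly supported variations) at all symmetric $\tilde E$, $C_S$ is differentiable, and $\delta C/\delta\tilde E$ and $C_S'$ vanish at zero momentum and only there. Put $\mathfrak Z[\xi]=A-ib\,\frac{\delta C}{\delta\tilde E}(\tilde E)$ for $\xi=(A,\tilde E)$ and $z[\xi]=c-i\frac b3C_S'(p)$ for $\xi\in\Gamma_S$. Assume that there is a holomorphic $s:\mathbb C\to\mathcal A^{\mathbb C}$ with $s(z[\xi])=\mathfrak Z[\xi]$ for all $\xi\in\Gamma_S$. Let $\hat C$ be a non-negative self-adjoint operator (the quantization of $C$) on $L^2(\overline{\mathcal A},\mu^o)$, where $\overline{\mathcal A}$ is the space of generalized connections and $\mu^o$ the Ashtekar–Lewandowski measure, and assume that $e^{-\hat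 C}$ maps $\underline{\mathrm{Cyl}}$ into itself. Let $\hat C_S=C_S(\hat p)$ with $\hat p=-i\frac b3\frac{d}{dc}$, so that $e^{-\hat C_S}e^{i\omega c}=e^{-C_S(b\omega/3)}e^{i\omega c}$. *Holomorphic transforms.* Assume that for $\Phi\in\underline{\mathrm{Cyl}}$ the function $e^{-\hat C}\Phi$ on $\mathcal A$ has a continuation $U\Phi$ to $\mathcal A^{\mathbb C}$ of the form $\tilde F(\mathfrak Z(e_1),\dots,\mathfrak Z(e_n))$ with $e_i$ straight and $\tilde F:\mathrm{SL}(2,\mathbb C)^n\to\mathbb C$ holomorphic, and that for $\phi\in\mathrm{Cyl}_S$ the function $e^{-\hat C_S}\phi$ on $\mathbb R$ has an entire continuation $U_S\phi$. The coherent state with label $\mathfrak Z$ is the functional $(\Psi^C_{\mathfrak Z}|\Phi\rangle=(U\Phi)(\mathfrak Z)$. Assume finally that $s^*U[\underline{\mathrm{Cyl}}]\subseteq U_S[\mathrm{Cyl}_S]$, so that $\pi=U_S^{-1}\circ s^*\circ U:\underline{\mathrm{Cyl}}\to\mathrm{Cyl}_S$ is defined on $\underline{\mathrm{Cyl}}$.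 The b-embedding is $\iota_b:\mathrm{Cyl}_S^*\to\underline{\mathrm{Cyl}}^*$, $(\iota_b\alpha)(\Phi)=\alpha(\pi\Phi)$. **Proposition.** The map $\pi$ is linear (so $\iota_b$ is well defined), the coherent states $(\Psi^C_{\mathfrak Z[\xi]}|$, $\xi\in\Gamma_S$, are linear functionals on $\underline{\mathrm{Cyl}}$, and the image of $\iota_b$ is precisely $$\operatorname{Im}\iota_b=\Big\{\Psi\in\underline{\mathrm{Cyl}}^*\ \Big|\ \forall\Phi\in\underline{\mathrm{Cyl}}:\ (U\Phi)|_{\mathfrak Z[\Gamma_S]}=0\ \Rightarrow\ \Psi(\Phi)=0\Big\}.$$ Equivalently, $\Psi\in\operatorname{Im}\iota_b$ if and only if $\Psi(\Phi)=0$ for every $\Phi\in\underline{\mathrm{Cyl}}$ such that $(\Psi^C_{\mathfrak Z[\xi]}|\Phi\rangle=0$ for all $\xi\in\Gamma_S$. -/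

import Mathlib

open MeasureTheory Filter Topology
open scoped ContDiff

noncomputable section

namespace BEmbedding

/-! ### Connections, triads and the Euclidean group -/

/-- The spatial manifold `ℝ³` in Cartesian coordinates. -/
abbrev Space := Fin 3 → ℝ

/-- Smooth fields `x ↦ (X x i a)`, with internal index `i` and spatial index `a`. -/
def SmoothField (𝕜 : Type) [RCLike 𝕜] : Submodule 𝕜 (Space → Fin 3 → Fin 3 → 𝕜) where
  carrier := {X | ContDiff ℝ ∞ X}
  add_mem' := by
    intro X Y hX hY
    exact ContDiff.add (𝕜 := ℝ) (n := ∞) hX hY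
  zero_mem' := by
    show ContDiff ℝ ∞ (fun _ : Space => (0 : Fin 3 → Fin 3 → 𝕜))
    exact contDiff_const
  smul_mem' := by
    intro c X hX
    exact ContDiff.const_smul (𝕜 := ℝ) (n := ∞) c hX

/-- Smooth `SU(2)` connections, `A x i a = A^i_a(x)`, components in the basis `τ_i`. -/
abbrev Conn := SmoothField ℝ

/-- Smooth densitized triads, `E x i a = E^a_i(x)`. -/
abbrev Triad := SmoothField ℝ

/-- Smooth `SL(2,ℂ)` connections. -/
abbrev ConnC := SmoothField ℂ

/-- The inclusion of real fields in complex ones. -/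
def toC (X : SmoothField ℝ) : ConnC :=
  ⟨fun x i a => (X.1 x i a : ℂ), by
    have h : ContDiff ℝ ∞ X.1 := X.2
    exact contDiff_pi.2 fun i => contDiff_pi.2 fun a =>
      Complex.ofRealCLM.contDiff.comp (contDiff_pi.1 (contDiff_pi.1 h i) a)⟩

/-- The Euclidean motion `φ_{(v,r)} : y ↦ r y + v` together with the constant gauge rotation
`r`, acting on a field: `(r^i_j (φ_* X)^j_a)`.  Since `r` is orthogonal with determinant one the
formula is the same for connections and for densitized triads. -/
def euclAct (v : Space) (r : Matrix.specialOrthogonalGroup (Fin 3) ℝ)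
    (X : Space → Fin 3 → Fin 3 → ℝ) : Space → Fin 3 → Fin 3 → ℝ :=
  fun y i a => ∑ j, ∑ b, r.1 i j * r.1 a b * X (r.1.transpose.mulVec (y - v)) j b

/-- Invariance of a field under the whole Euclidean group. -/
def IsSymmetric (X : SmoothField ℝ) : Prop :=
  ∀ v r, euclAct v r X.1 = X.1

/-- The symmetric phase space `Γ_S`: the invariant pairs `(A, E)`. -/
def symPhase : Set (Conn × Triad) :=
  {ξ | IsSymmetric ξ.1 ∧ IsSymmetric ξ.2}

/-- The reference triad `e^a_i` with `e^a_i A₀^j_a = ℓ⁻¹ δ^j_i`; the entry is `(a, i)`. -/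
def refTriad (ℓ : ℝ) (A₀ : Conn) (x : Space) : Matrix (Fin 3) (Fin 3) ℝ :=
  ℓ⁻¹ • (Matrix.of (A₀.1 x))⁻¹

/-- The densitized reference triad `√q e^a_i`, where `q` is the metric with orthonormal frame
`e_i`, so that `√q = |det e|⁻¹`. -/
def refDensTriad (ℓ : ℝ) (A₀ : Conn) : Space → Fin 3 → Fin 3 → ℝ :=
  fun x i a => |(refTriad ℓ A₀ x).det|⁻¹ * refTriad ℓ A₀ x a i

/-- `(c, p)` are the coordinates of `ξ`: `A = c A₀` and `E = p ℓ⁻² √q e`. -/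
def HasCoords (ℓ : ℝ) (A₀ : Conn) (ξ : Conn × Triad) (c p : ℝ) : Prop :=
  ξ.1 = c • A₀ ∧ ∀ x i a, ξ.2.1 x i a = p * (ℓ ^ 2)⁻¹ * refDensTriad ℓ A₀ x i a

/-! ### Holonomies along straight edges and cylindrical functions -/

/-- The basis `τ_i = -(i/2) σ_i` of `su(2)`. -/
def tau : Fin 3 → Matrix (Fin 2) (Fin 2) ℂ :=
  ![(-(Complex.I / 2)) • !![0, 1; 1, 0],
    (-(Complex.I / 2)) • !![0, -Complex.I; Complex.I, 0],
    (-(Complex.I / 2)) • !![1, 0; 0, -1]]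

/-- An oriented straight edge from `src` to `tgt`. -/
structure Edge where
  src : Space
  tgt : Space
  ne : src ≠ tgt

/-- The affine parametrization of a straight edge on `[0,1]`. -/
def Edge.param (e : Edge) (t : ℝ) : Space := e.src + t • (e.tgt - e.src)

/-- The `sl(2,ℂ)` element `Z^i_a(e(t)) ė^a τ_i`. -/
def pullback (Z : ConnC) (e : Edge) (t : ℝ) : Matrix (Fin 2) (Fin 2) ℂ :=
  ∑ i, ∑ a, (Z.1 (e.param t) i a * ((e.tgt a - e.src a : ℝ) : ℂ)) • tau i

/-- Parallel transport along `e`: `h' = Z(ė) h`, `h(0) = 1`. -/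
def IsTransport (Z : ConnC) (e : Edge) (h : ℝ → Matrix (Fin 2) (Fin 2) ℂ) : Prop :=
  h 0 = 1 ∧ ∀ t j k, HasDerivAt (fun u => h u j k) ((pullback Z e t * h t) j k) t

open Classical in
/-- The holonomy `Z(e)`: the value at `1` of the (unique) parallel transport along `e`. -/
def hol (Z : ConnC) (e : Edge) : Matrix (Fin 2) (Fin 2) ℂ :=
  if h : ∃ h, IsTransport Z e h then h.choose 1 else 1

/-- `n`-tuples of complex `2 × 2` matrices, as a normed space. -/
abbrev Tuple (n : ℕ) := Fin n → Fin 2 → Fin 2 → ℂ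

/-- `SU(2)ⁿ` inside the tuples of matrices. -/
def SUn (n : ℕ) : Set (Tuple n) :=
  {g | ∀ i, Matrix.of (g i) ∈ Matrix.specialUnitaryGroup (Fin 2) ℂ}

/-- `SL(2,ℂ)ⁿ` inside the tuples of matrices. -/
def SLn (n : ℕ) : Set (Tuple n) :=
  {g | ∀ i, (Matrix.of (g i)).det = 1}

/-- `Φ(A) = F(A(e₁), …, A(eₙ))` with `F` real analytic on `SU(2)ⁿ`; a function on this compact
submanifold is real analytic iff it is the restriction of one that is real analytic near it. -/
def IsRep (Φ : Conn → ℂ) {n : ℕ} (e : Fin n → Edge) (F : Tuple n → ℂ) : Prop :=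
  AnalyticOnNhd ℝ F (SUn n) ∧ ∀ A : Conn, Φ A = F fun i => hol (toC A) (e i)

/-- The straight-edge cylindrical functions on the space of smooth connections. -/
def StraightCyl : Submodule ℂ (Conn → ℂ) where
  carrier := {Φ | ∃ (n : ℕ) (e : Fin n → Edge) (F : Tuple n → ℂ), IsRep Φ e F}
  zero_mem' := ⟨0, Fin.elim0, fun _ => 0, fun _ _ => analyticAt_const, fun _ => rfl⟩
  smul_mem' := by
    rintro c Φ ⟨n, e, F, hF, h⟩
    exact ⟨n, e, fun g => c * F g, fun g hg => analyticAt_const.mul (hF g hg),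
      fun A => by simp [h A]⟩
  add_mem' := by
    rintro Φ₁ Φ₂ ⟨n, e, F, hF, h⟩ ⟨m, e', F', hF', h'⟩
    let L : Tuple (n + m) →L[ℝ] Tuple n :=
      ContinuousLinearMap.pi fun i => ContinuousLinearMap.proj (Fin.castAdd m i)
    let L' : Tuple (n + m) →L[ℝ] Tuple m :=
      ContinuousLinearMap.pi fun i => ContinuousLinearMap.proj (Fin.natAdd n i)
    refine ⟨n + m, Fin.append e e', fun g => F (L g) + F' (L' g), fun g hg => ?_, fun A => ?_⟩
    · exact ((hF (L g) fun i => hg _).comp (L.analyticAt g)).add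
        ((hF' (L' g) fun i => hg _).comp (L'.analyticAt g))
    · simp only [Pi.add_apply, h A, h' A]
      congr 2
      · funext i
        show _ = hol (toC A) (Fin.append e e' (Fin.castAdd m i))
        rw [Fin.append_left]
      · funext i
        show _ = hol (toC A) (Fin.append e e' (Fin.natAdd n i))
        rw [Fin.append_right]

/-- `c ↦ c A₀`. -/
def rMap (A₀ : Conn) (c : ℝ) : Conn := c • A₀

/-- The reduced cylindrical functions `Cyl_S = r^*[straight-edge Cyl]`. -/
def CylS (A₀ : Conn) : Submodule ℂ (ℝ → ℂ) :=
  StraightCyl.map (LinearMap.funLeft ℂ ℂ (rMap A₀))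

/-! ### The kinematical Hilbert space `L²(𝒜̄, μ°)` -/

/-- Analytic with nowhere vanishing velocity on `[a,b]`. -/
def IsAnalyticArc (γ : ℝ → Space) (a b : ℝ) : Prop :=
  AnalyticOn ℝ γ (Set.Icc a b) ∧
    ∀ t ∈ Set.Icc a b, derivWithin γ (Set.Icc a b) t ≠ 0

/-- Piecewise analytic curves, parametrized by `[0,1]` (values outside are irrelevant). -/
structure Curve where
  toFun : ℝ → Space
  piecewise : ∃ (n : ℕ) (t : Fin (n + 2) → ℝ), StrictMono t ∧ t 0 = 0 ∧ t (Fin.last _) = 1 ∧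
    ∀ i : Fin (n + 1), IsAnalyticArc toFun (t i.castSucc) (t i.succ)

/-- `e'` is an orientation preserving reparametrization of `e`. -/
def IsReparam (e e' : Curve) : Prop :=
  ∃ φ : ℝ → ℝ, ContinuousOn φ (Set.Icc 0 1) ∧ StrictMonoOn φ (Set.Icc 0 1) ∧ φ 0 = 0 ∧ φ 1 = 1 ∧
    ∀ t ∈ Set.Icc (0 : ℝ) 1, e'.toFun t = e.toFun (φ t)

/-- `e = e₂ ∘ e₁`: first `e₁`, then `e₂`. -/
def IsComp (e e₁ e₂ : Curve) : Prop :=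
  ∀ t ∈ Set.Icc (0 : ℝ) 1, e.toFun (t / 2) = e₁.toFun t ∧ e.toFun ((t + 1) / 2) = e₂.toFun t

/-- `e' = e⁻¹`. -/
def IsReverse (e e' : Curve) : Prop :=
  ∀ t ∈ Set.Icc (0 : ℝ) 1, e'.toFun t = e.toFun (1 - t)

/-- The group `SU(2)`. -/
abbrev SU2 := Matrix.specialUnitaryGroup (Fin 2) ℂ

instance : MeasurableSpace SU2 := borel SU2

/-- Generalized connections: morphisms from the groupoid of piecewise analytic curves to
`SU(2)`. -/
def GenConn : Type :=
  {A : Curve → SU2 // (∀ e e', IsReparam e e' → A e' = A e) ∧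
    (∀ e e₁ e₂, IsComp e e₁ e₂ → A e = A e₂ * A e₁) ∧
    (∀ e e', IsReverse e e' → A e' = (A e)⁻¹)}

/-- The σ-algebra generated by the holonomies. -/
instance : MeasurableSpace GenConn := inferInstanceAs (MeasurableSpace (Subtype _))

/-- The edges of a graph: embedded analytic arcs meeting at most in end points. -/
def IsGraph {n : ℕ} (e : Fin n → Curve) : Prop :=
  (∀ i, IsAnalyticArc (e i).toFun 0 1 ∧ Set.InjOn (e i).toFun (Set.Icc 0 1)) ∧
    ∀ i j, i ≠ j → ∀ s ∈ Set.Icc (0 : ℝ) 1, ∀ t ∈ Set.Icc (0 : ℝ) 1,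
      (e i).toFun s = (e j).toFun t → (s = 0 ∨ s = 1) ∧ (t = 0 ∨ t = 1)

/-- The characterization of the Ashtekar–Lewandowski measure: for every graph the joint law of
the holonomies is the normalized Haar measure of `SU(2)ⁿ`, i.e. the left invariant probability. -/
def IsALMeasure (μ : Measure GenConn) : Prop :=
  IsProbabilityMeasure μ ∧ ∀ (n : ℕ) (e : Fin n → Curve), IsGraph e →
    (μ.map fun A : GenConn => fun i => A.1 (e i)).IsMulLeftInvariant

open Classical in
/-- The Ashtekar–Lewandowski measure. -/
def alMeasure : Measure GenConn :=
  if h : ∃ μ, IsALMeasure μ then h.choose else 0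

/-- The kinematical Hilbert space. -/
abbrev KinHilbert := Lp ℂ 2 alMeasure

/-- A straight edge as a piecewise analytic curve. -/
def Edge.toCurve (e : Edge) : Curve where
  toFun := e.param
  piecewise := by
    have hd : ∀ t, HasDerivAt e.param (e.tgt - e.src) t := fun t => by
      have h := ((hasDerivAt_id t).smul_const (e.tgt - e.src)).const_add e.src
      rw [one_smul] at h
      exact h
    refine ⟨0, ![0, 1], ?_, rfl, rfl, fun i => ?_⟩
    · intro i j hij
      fin_cases i <;> fin_cases j <;> simp_all
    · fin_cases i
      refine ⟨?_, fun t ht => ?_⟩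
      · intro t _
        have : AnalyticAt ℝ e.param t :=
          analyticAt_const.add (analyticAt_id.smul analyticAt_const)
        exact this.analyticWithinAt
      · have hu : UniqueDiffWithinAt ℝ (Set.Icc (0 : ℝ) 1) t :=
          uniqueDiffOn_Icc one_pos t (by simpa using ht)
        have := (hd t).hasDerivWithinAt.derivWithin hu
        simp only [Fin.zero_eta, Fin.castSucc_zero, Matrix.cons_val_zero, Fin.succ_zero_eq_one,
          Matrix.cons_val_one]
        rw [this]
        exact sub_ne_zero.2 e.ne.symm

/-- `ψ` is the cylindrical function `Φ`, extended to generalized connections, as an element of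
the kinematical Hilbert space. -/
def IsState (Φ : StraightCyl) (ψ : KinHilbert) : Prop :=
  ∃ (n : ℕ) (e : Fin n → Edge) (F : Tuple n → ℂ), IsRep Φ.1 e F ∧
    (ψ : GenConn → ℂ) =ᵐ[alMeasure] fun A => F fun i => ((A.1 (e i).toCurve : SU2).1 : _)

/-- `ψ' = e^{-C} ψ` for a non-negative self-adjoint operator `C`: `ψ'` is the value at time `1`
of the solution of `u' = -C u`, `u(0) = ψ`. -/
def IsExpNeg (C : KinHilbert →ₗ.[ℂ] KinHilbert) (ψ ψ' : KinHilbert) : Prop :=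
  ∃ u : ℝ → KinHilbert, u 0 = ψ ∧ u 1 = ψ' ∧ ContinuousOn u (Set.Icc 0 1) ∧
    ∀ t ∈ Set.Ioo (0 : ℝ) 1, ∃ h : u t ∈ C.domain, HasDerivAt u (-(C ⟨u t, h⟩)) t

/-- A non-negative self-adjoint operator. -/
def IsNonnegSelfAdjoint (C : KinHilbert →ₗ.[ℂ] KinHilbert) : Prop :=
  IsSelfAdjoint C ∧ ∀ ψ : C.domain, 0 ≤ (inner ℂ (ψ : KinHilbert) (C ψ)).re

/-- `T` is the restriction of `e^{-C}` to the straight-edge cylindrical functions. -/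
def IsExpNegOnCyl (C : KinHilbert →ₗ.[ℂ] KinHilbert)
    (T : StraightCyl →ₗ[ℂ] StraightCyl) : Prop :=
  ∀ Φ, ∃ ψ ψ', IsState Φ ψ ∧ IsState (T Φ) ψ' ∧ IsExpNeg C ψ ψ'

/-! ### Classical complexifiers depending on the momentum only -/

/-- A non-negative functional of the densitized triad, given through its contributions `C R` from
an increasing exhaustion of space (so that functionals such as the total volume, which are
infinite on homogeneous fields, are included; a finite functional is a constant family). -/
structure Complexifier where
  toFun : ℝ → Triad → ℝ
  nonneg : ∀ R E, 0 ≤ toFun R E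
  mono : ∀ E, Monotone fun R => toFun R E

/-- `D = δC/δE` at `E`: for every compactly supported variation `f`, the derivative of `C` in the
direction `f` is `∫ D^i_a f^a_i`. -/
def HasFuncDeriv (C : Complexifier) (E : Triad) (D : Conn) : Prop :=
  ∀ f : Triad, HasCompactSupport f.1 →
    (∀ᶠ R in atTop, DifferentiableAt ℝ (fun t : ℝ => C.toFun R (E + t • f)) 0) ∧
    Tendsto (fun R => deriv (fun t : ℝ => C.toFun R (E + t • f)) 0) atTop
      (𝓝 (∫ x, ∑ i, ∑ a, D.1 x i a * f.1 x i a))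

open Classical in
/-- The functional derivative `δC/δE`. -/
def funcDeriv (C : Complexifier) (E : Triad) : Conn :=
  if h : ∃ D, HasFuncDeriv C E D then h.choose else 0

/-- The complex coordinate `𝔷 = A - i b δC/δE` on phase space, `b = 8πGγ`. -/
def frakZ (b : ℝ) (C : Complexifier) (ξ : Conn × Triad) : ConnC :=
  toC ξ.1 - (Complex.I * (b : ℂ)) • toC (funcDeriv C ξ.2)

/-- The complex coordinate `z = c - i (b/3) C_S'(p)` on the reduced phase space. -/
def redZ (b : ℝ) (CS : ℝ → ℝ) (c p : ℝ) : ℂ :=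
  (c : ℂ) - Complex.I * ((b / 3 * deriv CS p : ℝ) : ℂ)

/-- `s` is the inclusion of the symmetric phase space, `s(z[ξ]) = 𝔷[ξ]`, and is holomorphic. -/
def IsHolInclusion (b ℓ : ℝ) (A₀ : Conn) (C : Complexifier) (CS : ℝ → ℝ) (s : ℂ → ConnC) : Prop :=
  (∀ ξ ∈ symPhase, ∀ c p, HasCoords ℓ A₀ ξ c p → s (redZ b CS c p) = frakZ b C ξ) ∧
    ∀ x i a, Differentiable ℂ fun z => (s z).1 x i a

/-! ### Holomorphic representations -/

/-- Holomorphic cylindrical functions `Z ↦ F(Z(e₁), …, Z(eₙ))` (straight edges), with `F`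
holomorphic on `SL(2,ℂ)ⁿ`, i.e. the restriction of a function holomorphic near it. -/
def IsHolCyl (Ψ : ConnC → ℂ) : Prop :=
  ∃ (n : ℕ) (e : Fin n → Edge) (F : Tuple n → ℂ),
    AnalyticOnNhd ℂ F (SLn n) ∧ ∀ Z : ConnC, Ψ Z = F fun i => hol Z (e i)

/-- `Ψ` is the analytic continuation of `Φ` from real to complex connections. -/
def IsContinuation (Φ : Conn → ℂ) (Ψ : ConnC → ℂ) : Prop :=
  IsHolCyl Ψ ∧ ∀ A : Conn, Ψ (toC A) = Φ A

open Classical in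
/-- The holomorphic transform `(UΦ)(𝔷) = (e^{-Ĉ}Φ)(A')_{A' → 𝔷}`; `T` is `e^{-Ĉ}`. -/
def holU (T : StraightCyl →ₗ[ℂ] StraightCyl) (Φ : StraightCyl) : ConnC → ℂ :=
  if h : ∃ Ψ, IsContinuation (T Φ).1 Ψ then h.choose else 0

/-- The coherent state `(Ψ^C_𝔷 |` on straight-edge cylindrical functions. -/
def coherentState (T : StraightCyl →ₗ[ℂ] StraightCyl) (Z : ConnC) : StraightCyl → ℂ :=
  fun Φ => holU T Φ Z

/-- The component of `φ` along `e^{iwc}` in `L²` of the Bohr compactification of `ℝ`. -/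
def bohrCoeff (φ : ℝ → ℂ) (w : ℝ) : ℂ :=
  limUnder atTop fun R : ℝ =>
    ((2 * R : ℝ) : ℂ)⁻¹ * ∫ c in (-R)..R, φ c * Complex.exp (-(Complex.I * w * c))

/-- `e^{-C_S(p̂)} φ` for `p̂ = -i (b/3) d/dc`, which has the eigenvectors `e^{iwc}` with
eigenvalues `bw/3`. -/
def expNegS (b : ℝ) (CS : ℝ → ℝ) (φ : ℝ → ℂ) : ℝ → ℂ := fun c =>
  ∑' w : ℝ, (Real.exp (-CS (b * w / 3)) : ℂ) * bohrCoeff φ w * Complex.exp (Complex.I * w * c)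

/-- `f` is the entire continuation of `φ`. -/
def IsEntireExtension (φ : ℝ → ℂ) (f : ℂ → ℂ) : Prop :=
  Differentiable ℂ f ∧ ∀ c : ℝ, f c = φ c

open Classical in
/-- The reduced holomorphic transform `(U_S φ)(z) = (e^{-Ĉ_S}φ)(c')_{c' → z}`. -/
def holUS (b : ℝ) (CS : ℝ → ℝ) (φ : ℝ → ℂ) : ℂ → ℂ :=
  if h : ∃ f, IsEntireExtension (expNegS b CS φ) f then h.choose else 0

/-! ### The b-embedding -/

open Classical in
/-- `π = U_S⁻¹ ∘ s^* ∘ U`. -/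
def piMap (b : ℝ) (A₀ : Conn) (CS : ℝ → ℝ) (T : StraightCyl →ₗ[ℂ] StraightCyl) (s : ℂ → ConnC)
    (Φ : StraightCyl) : CylS A₀ :=
  if h : ∃ φ : CylS A₀, holUS b CS φ.1 = fun z => holU T Φ (s z) then h.choose else 0

/-- The b-embedding `ι_b : Cyl_S^* → (straight-edge Cyl)^*`, `(ι_b α)(Φ) = α(π Φ)`. -/
def iotaB {A₀ : Conn} {P : StraightCyl → CylS A₀} (hP : IsLinearMap ℂ P) :
    Module.Dual ℂ (CylS A₀) →ₗ[ℂ] Module.Dual ℂ StraightCyl :=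
  (hP.mk' P).dualMap

end BEmbedding

end

/-!
The invariant connections form a line through `A₀`, along which every holonomy is a matrix-valued
combination of a cosine and a sine of the parameter times a frequency. Hence the elements of
`CylS A₀` are restrictions of smooth functions on tori to lines: almost periodic functions with an
absolutely convergent Bohr series, on which `expNegS` multiplies the coefficients by nonzero bounded
numbers. So `holUS` is linear and injective on `CylS A₀`.

By the identity theorem `s z = z • toC A₀`, so `Φ ↦ holU T Φ ∘ s` is linear, and with it the
projection. The set of labels `frakZ '' symPhase` contains the real points of the complex line
`range s` and lies in that line; by the identity theorem again, the projection kills `Φ` exactly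
when `holU T Φ` vanishes on the labels. The range of the dual map is the annihilator of this kernel.
-/

noncomputable section

/-! ### Fourier series of smooth functions on the torus -/

namespace TorusFourier

open UnitAddTorus

variable {d : Type*}

/-- The covering map `ℝᵈ → 𝕋ᵈ`. -/
def proj (x : d → ℝ) : UnitAddTorus d := fun j => (x j : UnitAddCircle)

theorem isOpenQuotientMap_proj : IsOpenQuotientMap (proj : (d → ℝ) → UnitAddTorus d) :=
  IsOpenQuotientMap.piMap fun _ => QuotientAddGroup.isOpenQuotientMap_mk

theorem proj_add_single [DecidableEq d] (x : d → ℝ) (j : d) (h : ℝ) :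
    proj x + Pi.single j (h : UnitAddCircle) = proj (x + Pi.single j h) := by
  ext i
  rcases eq_or_ne i j with rfl | hij
  · simp [proj]
  · simp [proj, hij]

theorem hasDerivAt_add_single [DecidableEq d] (x : d → ℝ) (j : d) (h : ℝ) :
    HasDerivAt (fun h : ℝ => x + Pi.single j h) (Pi.single j (1 : ℝ)) h := by
  rw [hasDerivAt_pi]
  intro i
  rcases eq_or_ne i j with rfl | hij
  · simpa using (hasDerivAt_id h).const_add (x i)
  · simpa [hij] using hasDerivAt_const h (x i)

variable [Fintype d]

theorem summable_pi_prod {α : Type*} {a : α → ℝ} (h0 : ∀ k, 0 ≤ a k) (ha : Summable a) :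
    Summable fun m : d → α => ∏ j, a (m j) := by
  classical
  refine summable_of_sum_le (c := ∏ _j : d, ∑' k, a k)
    (fun m => Finset.prod_nonneg fun j _ => h0 _) fun u => ?_
  calc ∑ m ∈ u, ∏ j, a (m j)
      ≤ ∑ m ∈ Fintype.piFinset fun j => u.image fun m => m j, ∏ j, a (m j) :=
        Finset.sum_le_sum_of_subset_of_nonneg
          (fun m hm => Fintype.mem_piFinset.2 fun j => Finset.mem_image_of_mem _ hm)
          fun m _ _ => Finset.prod_nonneg fun j _ => h0 _
    _ = ∏ j : d, ∑ k ∈ u.image fun m => m j, a k := by rw [Finset.prod_univ_sum]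
    _ ≤ ∏ _j : d, ∑' k, a k :=
        Finset.prod_le_prod (fun j _ => Finset.sum_nonneg fun k _ => h0 k)
          fun j _ => ha.sum_le_tsum _ fun k _ => h0 k

/-- The normalized Haar measure of `𝕋ᵈ`, for which the Fourier coefficients are defined. -/
abbrev haar (d : Type*) [Fintype d] : Measure (UnitAddTorus d) :=
  Measure.pi fun _ => AddCircle.haarAddCircle

theorem mFourierCoeff_eq_integral (f : UnitAddTorus d → ℂ) (m : d → ℤ) :
    mFourierCoeff f m = ∫ t, mFourier (-m) t * f t ∂haar d := rfl

theorem mFourier_proj (m : d → ℤ) (x : d → ℝ) :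
    mFourier m (proj x) = Complex.exp (2 * Real.pi * Complex.I * ∑ j, m j * x j) := by
  simp only [mFourier, proj, ContinuousMap.coe_mk, fourier_coe_apply]
  push_cast
  rw [Finset.mul_sum, Complex.exp_sum]
  refine Finset.prod_congr rfl fun j _ => ?_
  simp only [div_one, mul_assoc]

theorem norm_mFourier_mul_le (m : d → ℤ) (t : UnitAddTorus d) (z : ℂ) :
    ‖mFourier m t * z‖ ≤ ‖z‖ := by
  have h : ‖mFourier m t‖ ≤ 1 := by
    simpa only [mFourier_norm] using (mFourier m).norm_coe_le_norm t
  simpa only [norm_mul] using mul_le_of_le_one_left (norm_nonneg z) h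

/-- Smooth functions on the torus, i.e. those with a smooth lift to `ℝᵈ`. -/
def IsSmooth (f : UnitAddTorus d → ℂ) : Prop := ContDiff ℝ ∞ fun x => f (proj x)

theorem isSmooth_mFourier (m : d → ℤ) : IsSmooth (mFourier m) := by
  unfold IsSmooth
  simp only [mFourier_proj]
  have hsum : ContDiff ℝ ∞ fun x : d → ℝ => ∑ j, m j * x j :=
    ContDiff.sum fun j _ => contDiff_const.mul (contDiff_apply ℝ ℝ j)
  exact (contDiff_const.mul (Complex.ofRealCLM.contDiff.comp hsum)).cexp

section IsSmooth

variable {f g : UnitAddTorus d → ℂ}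

theorem IsSmooth.mul (hf : IsSmooth f) (hg : IsSmooth g) : IsSmooth fun t => f t * g t :=
  ContDiff.mul hf hg

theorem IsSmooth.sub (hf : IsSmooth f) (hg : IsSmooth g) : IsSmooth fun t => f t - g t :=
  ContDiff.sub hf hg

theorem IsSmooth.continuous (hf : IsSmooth f) : Continuous f :=
  isOpenQuotientMap_proj.isQuotientMap.continuous_iff.2 (ContDiff.continuous hf)

theorem IsSmooth.integrable (hf : IsSmooth f) : Integrable f (haar d) :=
  hf.continuous.integrable_of_hasCompactSupport (HasCompactSupport.of_compactSpace _)

theorem IsSmooth.exists_norm_le (hf : IsSmooth f) : ∃ K, ∀ t, ‖f t‖ ≤ K := by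
  simpa using isCompact_univ.exists_bound_of_continuousOn hf.continuous.continuousOn

theorem mFourierCoeff_sub (hf : IsSmooth f) (hg : IsSmooth g) (m : d → ℤ) :
    mFourierCoeff (fun t => f t - g t) m = mFourierCoeff f m - mFourierCoeff g m := by
  simp only [mFourierCoeff_eq_integral, mul_sub]
  exact integral_sub ((isSmooth_mFourier _).mul hf).integrable
    ((isSmooth_mFourier _).mul hg).integrable

theorem norm_mFourierCoeff_le {K : ℝ} (hK : ∀ t, ‖f t‖ ≤ K) (m : d → ℤ) :
    ‖mFourierCoeff f m‖ ≤ K := by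
  rw [mFourierCoeff_eq_integral]
  simpa using norm_integral_le_of_norm_le_const (μ := haar d)
    (Eventually.of_forall fun t => (norm_mFourier_mul_le (-m) t _).trans (hK t))

end IsSmooth

/-! ### Integration by parts on the torus -/

section PartialDeriv

variable [DecidableEq d]

/-- The partial derivative in the direction `j`, taken along translations of the torus. -/
def partialDeriv (j : d) (f : UnitAddTorus d → ℂ) (t : UnitAddTorus d) : ℂ :=
  deriv (fun h : ℝ => f (t + Pi.single j (h : UnitAddCircle))) 0

variable {f g : UnitAddTorus d → ℂ}

theorem IsSmooth.hasDerivAt_proj_add_single (hf : IsSmooth f) (j : d) (x : d → ℝ) (h : ℝ) :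
    HasDerivAt (fun h : ℝ => f (proj x + Pi.single j (h : UnitAddCircle)))
      (fderiv ℝ (fun x => f (proj x)) (x + Pi.single j h) (Pi.single j 1)) h := by
  simp only [proj_add_single]
  exact (ContDiff.differentiable hf (by simp) _).hasFDerivAt.comp_hasDerivAt h
    (hasDerivAt_add_single x j h)

theorem IsSmooth.partialDeriv_proj (hf : IsSmooth f) (j : d) (x : d → ℝ) :
    partialDeriv j f (proj x) = fderiv ℝ (fun x => f (proj x)) x (Pi.single j 1) := by
  simpa only [Pi.single_zero, add_zero, TorusFourier.partialDeriv] using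
    (hf.hasDerivAt_proj_add_single j x 0).deriv

theorem IsSmooth.partialDeriv (hf : IsSmooth f) (j : d) : IsSmooth (partialDeriv j f) := by
  unfold IsSmooth
  simp only [hf.partialDeriv_proj]
  exact (ContDiff.fderiv_right hf (m := ∞) (by simp)).clm_apply contDiff_const

theorem IsSmooth.hasDerivAt_translate (hf : IsSmooth f) (j : d) (t : UnitAddTorus d) (h : ℝ) :
    HasDerivAt (fun h : ℝ => f (t + Pi.single j (h : UnitAddCircle)))
      (TorusFourier.partialDeriv j f (t + Pi.single j (h : UnitAddCircle))) h := by
  obtain ⟨x, rfl⟩ := isOpenQuotientMap_proj.surjective t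
  rw [proj_add_single, hf.partialDeriv_proj]
  exact hf.hasDerivAt_proj_add_single j x h

theorem partialDeriv_mul (hf : IsSmooth f) (hg : IsSmooth g) (j : d) (t : UnitAddTorus d) :
    partialDeriv j (fun t => f t * g t) t =
      partialDeriv j f t * g t + f t * partialDeriv j g t := by
  rw [partialDeriv]
  simpa only [AddCircle.coe_zero, Pi.single_zero, add_zero] using
    ((hf.hasDerivAt_translate j t 0).fun_mul (hg.hasDerivAt_translate j t 0)).deriv

theorem partialDeriv_mFourier (m : d → ℤ) (j : d) (t : UnitAddTorus d) :
    partialDeriv j (mFourier m) t = 2 * Real.pi * Complex.I * m j * mFourier m t := by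
  obtain ⟨x, rfl⟩ := isOpenQuotientMap_proj.surjective t
  have hsum : HasDerivAt (fun h : ℝ => ∑ i, m i * (x + Pi.single j h : d → ℝ) i)
      (∑ i, m i * (Pi.single j (1 : ℝ) : d → ℝ) i) 0 :=
    HasDerivAt.fun_sum fun i _ =>
      ((hasDerivAt_pi.1 (hasDerivAt_add_single x j 0)) i).const_mul _
  have hexp := (hsum.ofReal_comp.const_mul (2 * Real.pi * Complex.I)).cexp.deriv
  simp only [← mFourier_proj, ← proj_add_single] at hexp
  rw [partialDeriv, hexp]
  simp [Pi.single_apply, mul_comm]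

theorem IsSmooth.hasDerivAt_integral_translate (hf : IsSmooth f) (j : d) :
    HasDerivAt (fun h : ℝ => ∫ t, f (t + Pi.single j (h : UnitAddCircle)) ∂haar d)
      (∫ t, TorusFourier.partialDeriv j f t ∂haar d) 0 := by
  let F : ℝ → UnitAddTorus d → ℂ := fun h t => f (t + Pi.single j (h : UnitAddCircle))
  let F' : ℝ → UnitAddTorus d → ℂ := fun h t =>
    TorusFourier.partialDeriv j f (t + Pi.single j (h : UnitAddCircle))
  obtain ⟨K, hK⟩ := (hf.partialDeriv j).exists_norm_le
  have hF (h : ℝ) : Continuous (F h) :=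
    hf.continuous.comp (continuous_id.add continuous_const)
  have hF0 : F 0 = f := by simp [F]
  have hF'0 : F' 0 = TorusFourier.partialDeriv j f := by simp [F']
  have hbound : ∀ t h, ‖F' h t‖ ≤ K := fun t h => hK _
  have hderiv : ∀ t h, HasDerivAt (F · t) (F' h t) h := hf.hasDerivAt_translate j
  rw [← hF'0]
  exact (hasDerivAt_integral_of_dominated_loc_of_deriv_le (bound := fun _ => K) univ_mem
    (Eventually.of_forall fun h => (hF h).aestronglyMeasurable) (hF0 ▸ hf.integrable)
    (hF'0 ▸ (hf.partialDeriv j).continuous.aestronglyMeasurable)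
    (Eventually.of_forall fun t h _ => hbound t h) (integrable_const K)
    (Eventually.of_forall fun t h _ => hderiv t h)).2

theorem IsSmooth.integral_partialDeriv_eq_zero (hf : IsSmooth f) (j : d) :
    ∫ t, TorusFourier.partialDeriv j f t ∂haar d = 0 := by
  have hderiv := hf.hasDerivAt_integral_translate j
  simp only [integral_add_right_eq_self] at hderiv
  exact hderiv.unique (hasDerivAt_const 0 _)

theorem IsSmooth.mFourierCoeff_partialDeriv (hf : IsSmooth f) (j : d) (m : d → ℤ) :
    mFourierCoeff (TorusFourier.partialDeriv j f) m =
      2 * Real.pi * Complex.I * m j * mFourierCoeff f m := by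
  have he := isSmooth_mFourier (-m)
  have hparts := (he.mul hf).integral_partialDeriv_eq_zero j
  simp only [partialDeriv_mul he hf, partialDeriv_mFourier, mul_assoc] at hparts
  rw [integral_add (((((he.mul hf).integrable.const_mul _).const_mul _).const_mul _).const_mul _)
    (he.mul (hf.partialDeriv j)).integrable] at hparts
  simp only [integral_const_mul, ← mFourierCoeff_eq_integral, Pi.neg_apply, Int.cast_neg]
    at hparts
  linear_combination hparts

end PartialDeriv

/-! ### Absolute convergence -/

variable {f : UnitAddTorus d → ℂ}

theorem IsSmooth.exists_mFourierCoeff_eq_prod_mul (hf : IsSmooth f) (s : Finset d) :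
    ∃ g, IsSmooth g ∧ ∀ m, mFourierCoeff g m =
      (∏ j ∈ s, (1 + (2 * Real.pi * m j) ^ 2 : ℝ) : ℝ) * mFourierCoeff f m := by
  classical
  induction s using Finset.induction_on with
  | empty => exact ⟨f, hf, by simp⟩
  | insert j s hj ih =>
    obtain ⟨g, hg, h⟩ := ih
    have hg' := hg.partialDeriv j
    refine ⟨_, hg.sub (hg'.partialDeriv j), fun m => ?_⟩
    rw [mFourierCoeff_sub hg (hg'.partialDeriv j), hg'.mFourierCoeff_partialDeriv,
      hg.mFourierCoeff_partialDeriv, h, Finset.prod_insert hj]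
    push_cast
    linear_combination (-(2 * Real.pi * m j) ^ 2 * (∏ j ∈ s, (1 + (2 * Real.pi * m j) ^ 2) : ℂ) *
      mFourierCoeff f m) * Complex.I_sq

theorem summable_inv_one_add_sq : Summable fun k : ℤ => (1 + (2 * Real.pi * k) ^ 2 : ℝ)⁻¹ := by
  refine Summable.of_norm_bounded_eventually
    (Real.summable_one_div_int_pow (p := 2) |>.2 one_lt_two) ?_
  filter_upwards [(Set.finite_singleton (0 : ℤ)).compl_mem_cofinite] with k hk
  have hk' : (0 : ℝ) < (k : ℝ) ^ 2 := by
    have : k ≠ 0 := hk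
    positivity
  have hpi : (1 : ℝ) ≤ (2 * Real.pi) ^ 2 := by nlinarith [Real.pi_gt_three]
  rw [Real.norm_of_nonneg (by positivity), one_div]
  exact inv_anti₀ hk' (by nlinarith)

theorem IsSmooth.summable_mFourierCoeff (hf : IsSmooth f) : Summable (mFourierCoeff f) := by
  obtain ⟨g, hg, h⟩ := hf.exists_mFourierCoeff_eq_prod_mul Finset.univ
  obtain ⟨K, hK⟩ := hg.exists_norm_le
  refine Summable.of_norm_bounded ((summable_pi_prod (d := d)
    (fun k : ℤ => by positivity) summable_inv_one_add_sq).mul_left K) fun m => ?_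
  have hpos : 0 < ∏ j, (1 + (2 * Real.pi * m j) ^ 2 : ℝ) :=
    Finset.prod_pos fun j _ => by positivity
  have hb := norm_mFourierCoeff_le hK m
  rw [h, norm_mul, Complex.norm_real, Real.norm_of_nonneg hpos.le] at hb
  rwa [Finset.prod_inv_distrib, ← div_eq_mul_inv, le_div_iff₀ hpos, mul_comm]

theorem IsSmooth.hasSum_mFourier (hf : IsSmooth f) (t : UnitAddTorus d) :
    HasSum (fun m => mFourierCoeff f m * mFourier m t) (f t) :=
  hasSum_mFourier_series_apply_of_summable (f := ⟨f, hf.continuous⟩) hf.summable_mFourierCoeff t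

end TorusFourier

namespace BEmbedding

/-! ### Absolutely convergent almost periodic functions -/

theorem norm_exp_I_mul_mul (w c : ℝ) : ‖Complex.exp (Complex.I * w * c)‖ = 1 := by
  rw [mul_assoc, ← Complex.ofReal_mul, Complex.norm_exp_I_mul_ofReal]

/-- The mean of `f` over `[-R, R]`; for `R = 0` division by zero makes it `0`. -/
def symmMean (f : ℝ → ℂ) (R : ℝ) : ℂ := ((2 * R : ℝ) : ℂ)⁻¹ * ∫ c in (-R)..R, f c

theorem norm_symmMean_le {f : ℝ → ℂ} {K : ℝ} (hf : ∀ c, ‖f c‖ ≤ K) (R : ℝ) :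
    ‖symmMean f R‖ ≤ K := by
  have hK : 0 ≤ K := (norm_nonneg _).trans (hf 0)
  have h := intervalIntegral.norm_integral_le_of_norm_le_const (a := -R) (b := R)
    fun c _ => hf c
  rw [sub_neg_eq_add, ← two_mul] at h
  rw [symmMean, norm_mul, norm_inv, Complex.norm_real, Real.norm_eq_abs, inv_mul_eq_div]
  exact div_le_of_le_mul₀ (abs_nonneg _) hK h

theorem tendsto_symmMean_const (k : ℂ) : Tendsto (symmMean fun _ => k) atTop (𝓝 k) := by
  refine tendsto_const_nhds.congr' ?_
  filter_upwards [eventually_gt_atTop 0] with R hR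
  have h2R : ((2 * R : ℝ) : ℂ) ≠ 0 := Complex.ofReal_ne_zero.2 (by positivity)
  rw [symmMean, intervalIntegral.integral_const, sub_neg_eq_add, ← two_mul, Complex.real_smul,
    inv_mul_cancel_left₀ h2R]

theorem tendsto_symmMean_exp {w : ℝ} (hw : w ≠ 0) :
    Tendsto (symmMean fun c => Complex.exp (Complex.I * w * c)) atTop (𝓝 0) := by
  refine squeeze_zero_norm' (a := fun R => |w|⁻¹ * R⁻¹) ?_ ?_
  · filter_upwards [eventually_gt_atTop 0] with R hR
    have hIw : Complex.I * w ≠ 0 := by simpa using hw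
    have hsub := norm_sub_le (Complex.exp (Complex.I * w * R))
      (Complex.exp (Complex.I * w * (-R : ℝ)))
    rw [norm_exp_I_mul_mul, norm_exp_I_mul_mul] at hsub
    rw [symmMean, integral_exp_mul_complex hIw, norm_mul, norm_div, norm_inv, Complex.norm_real,
      Real.norm_of_nonneg (by positivity), norm_mul, Complex.norm_I, one_mul, Complex.norm_real,
      Real.norm_eq_abs]
    calc (2 * R)⁻¹ * (_ / |w|) ≤ (2 * R)⁻¹ * ((1 + 1) / |w|) := by gcongr
      _ = |w|⁻¹ * R⁻¹ := by field_simp; norm_num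
  · simpa using tendsto_inv_atTop_zero.const_mul |w|⁻¹

/-- `φ(c) = ∑ a(w) e^{iwc}` with an absolutely summable family of coefficients, indexed by all
real frequencies. -/
structure HasBohrSeries (φ a : ℝ → ℂ) : Prop where
  summable : Summable a
  hasSum (c : ℝ) : HasSum (fun w : ℝ => a w * Complex.exp (Complex.I * w * c)) (φ c)

namespace HasBohrSeries

variable {φ ψ a a' : ℝ → ℂ}

theorem of_hasSum {ι : Type*} {α : ι → ℂ} {ν : ι → ℝ} (hα : Summable α)
    (h : ∀ c : ℝ, HasSum (fun i => α i * Complex.exp (Complex.I * ν i * c)) (φ c)) :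
    HasBohrSeries φ fun w => ∑' i : {i // ν i = w}, α i := by
  have hs : Summable fun x : Σ w, {i // ν i = w} => α x.2 :=
    (Equiv.sigmaFiberEquiv ν).summable_iff.2 hα
  refine ⟨hs.sigma, fun c => ((Equiv.sigmaFiberEquiv ν).hasSum_iff.2 (h c)).sigma fun w => ?_⟩
  refine ((hs.sigma_factor w).hasSum.mul_right (Complex.exp (Complex.I * w * c))).congr_fun
    fun i => ?_
  simp [Equiv.sigmaFiberEquiv, i.2]

theorem add (hφ : HasBohrSeries φ a) (hψ : HasBohrSeries ψ a') :
    HasBohrSeries (φ + ψ) (a + a') :=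
  ⟨hφ.summable.add hψ.summable, fun c => by
    simpa only [Pi.add_apply, add_mul] using (hφ.hasSum c).add (hψ.hasSum c)⟩

theorem smul (k : ℂ) (hφ : HasBohrSeries φ a) : HasBohrSeries (k • φ) (k • a) :=
  ⟨hφ.summable.const_smul k, fun c => by
    simpa only [Pi.smul_apply, smul_eq_mul, mul_assoc] using (hφ.hasSum c).mul_left k⟩

theorem mul_exp_neg (hφ : HasBohrSeries φ a) (w : ℝ) :
    HasBohrSeries (fun c => φ c * Complex.exp (-(Complex.I * w * c))) fun v => a (v + w) := by
  refine ⟨(Equiv.addRight w).summable_iff.2 hφ.summable, fun c => ?_⟩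
  refine ((Equiv.addRight w).hasSum_iff.2
    ((hφ.hasSum c).mul_right (Complex.exp (-(Complex.I * w * c))))).congr_fun fun v => ?_
  simp only [Function.comp_apply, Equiv.coe_addRight, mul_assoc, ← Complex.exp_add]
  push_cast
  ring_nf

theorem hasSum_symmMean (hφ : HasBohrSeries φ a) (R : ℝ) :
    HasSum (fun w => a w * symmMean (fun c => Complex.exp (Complex.I * w * c)) R)
      (symmMean φ R) := by
  -- Only countably many frequencies occur, so the series may be integrated term by term.
  have : Countable (Function.support a) := hφ.summable.countable_support
  have hint := intervalIntegral.hasSum_integral_of_dominated_convergence (μ := volume)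
    (a := -R) (b := R) (f := φ)
    (F := fun (w : Function.support a) (c : ℝ) => a w * Complex.exp (Complex.I * (w : ℝ) * c))
    (fun w _ => ‖a w‖)
    (fun w => Continuous.aestronglyMeasurable (by fun_prop))
    (fun w => Eventually.of_forall fun c _ => by rw [norm_mul, norm_exp_I_mul_mul, mul_one])
    (Eventually.of_forall fun c _ => hφ.summable.norm.subtype _) intervalIntegrable_const
    (Eventually.of_forall fun c _ => (hasSum_subtype_iff_of_support_subset
      (Function.support_mul_subset_left _ _)).2 (hφ.hasSum c))
  simp only [intervalIntegral.integral_const_mul] at hint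
  refine (hasSum_subtype_iff_of_support_subset (Function.support_mul_subset_left _ _)).1 ?_
  simpa only [symmMean, Function.comp_def, mul_left_comm] using
    hint.mul_left ((2 * R : ℝ) : ℂ)⁻¹

theorem tendsto_symmMean (hφ : HasBohrSeries φ a) : Tendsto (symmMean φ) atTop (𝓝 (a 0)) := by
  have hlim := tendsto_tsum_of_dominated_convergence (𝓕 := atTop)
    (f := fun R w => a w * symmMean (fun c => Complex.exp (Complex.I * w * c)) R)
    (g := Pi.single 0 (a 0)) (bound := fun w => ‖a w‖) hφ.summable.norm
    (fun w => by
      rcases eq_or_ne w 0 with rfl | hw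
      · simpa using (tendsto_symmMean_const 1).const_mul (a 0)
      · simpa [hw] using (tendsto_symmMean_exp hw).const_mul (a w))
    (Eventually.of_forall fun R w => by
      rw [norm_mul]
      exact mul_le_of_le_one_right (norm_nonneg _)
        (norm_symmMean_le (fun c => (norm_exp_I_mul_mul w c).le) R))
  simpa only [(hφ.hasSum_symmMean _).tsum_eq, tsum_pi_single] using hlim

theorem bohrCoeff_eq (hφ : HasBohrSeries φ a) : bohrCoeff φ = a := by
  funext w
  exact (hφ.mul_exp_neg w).tendsto_symmMean.limUnder_eq.trans (congrArg a (zero_add w))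

theorem eq_of_coeff_eq (hφ : HasBohrSeries φ a) (hψ : HasBohrSeries ψ a) : φ = ψ :=
  funext fun c => (hφ.hasSum c).unique (hψ.hasSum c)

theorem expNegS {CS : ℝ → ℝ} (hCS : BddBelow (Set.range CS)) (b : ℝ) (hφ : HasBohrSeries φ a) :
    HasBohrSeries (expNegS b CS φ) fun w => (Real.exp (-CS (b * w / 3)) : ℂ) * a w := by
  obtain ⟨m, hm⟩ := hCS
  have hsum : Summable fun w => (Real.exp (-CS (b * w / 3)) : ℂ) * a w := by
    refine Summable.of_norm_bounded (hφ.summable.norm.mul_left (Real.exp (-m))) fun w => ?_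
    rw [norm_mul, Complex.norm_real, Real.norm_of_nonneg (Real.exp_pos _).le]
    gcongr
    exact hm (Set.mem_range_self _)
  refine ⟨hsum, fun c => ?_⟩
  rw [BEmbedding.expNegS, hφ.bohrCoeff_eq]
  refine (Summable.of_norm_bounded hsum.norm fun w => ?_).hasSum
  rw [norm_mul _ (Complex.exp _), norm_exp_I_mul_mul, mul_one]

end HasBohrSeries

/-- The functions on `ℝ` with an absolutely convergent Bohr series. -/
def almostPeriodic : Submodule ℂ (ℝ → ℂ) where
  carrier := {φ | ∃ a, HasBohrSeries φ a}
  add_mem' := fun ⟨_, hφ⟩ ⟨_, hψ⟩ => ⟨_, hφ.add hψ⟩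
  zero_mem' := ⟨0, summable_zero, fun c => by simp [hasSum_zero]⟩
  smul_mem' := fun k _ ⟨_, hφ⟩ => ⟨_, hφ.smul k⟩

theorem comp_line_mem_almostPeriodic {d : Type*} [Fintype d]
    {f : UnitAddTorus d → ℂ} (hf : TorusFourier.IsSmooth f) (ν : d → ℝ) :
    (fun c : ℝ => f (TorusFourier.proj (c • ν))) ∈ almostPeriodic := by
  refine ⟨_, HasBohrSeries.of_hasSum (ν := fun m : d → ℤ => 2 * Real.pi * ∑ j, m j * ν j)
    hf.summable_mFourierCoeff fun c => ?_⟩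
  convert hf.hasSum_mFourier (TorusFourier.proj (c • ν)) using 3 with m
  rw [TorusFourier.mFourier_proj]
  congr 1
  simp only [Pi.smul_apply, smul_eq_mul, mul_left_comm _ c, ← Finset.mul_sum]
  push_cast
  ring

section expNegS

variable {φ ψ : ℝ → ℂ} {CS : ℝ → ℝ} {b : ℝ}

theorem expNegS_add (hCS : BddBelow (Set.range CS)) (hφ : φ ∈ almostPeriodic)
    (hψ : ψ ∈ almostPeriodic) :
    expNegS b CS (φ + ψ) = expNegS b CS φ + expNegS b CS ψ := by
  obtain ⟨⟨_, hφ⟩, _, hψ⟩ := And.intro hφ hψ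
  refine ((hφ.add hψ).expNegS hCS b).eq_of_coeff_eq ?_
  simpa only [Pi.add_def, mul_add] using (hφ.expNegS hCS b).add (hψ.expNegS hCS b)

theorem expNegS_smul (hCS : BddBelow (Set.range CS)) (hφ : φ ∈ almostPeriodic) (k : ℂ) :
    expNegS b CS (k • φ) = k • expNegS b CS φ := by
  obtain ⟨_, hφ⟩ := hφ
  refine ((hφ.smul k).expNegS hCS b).eq_of_coeff_eq ?_
  simpa only [Pi.smul_def, smul_eq_mul, mul_left_comm] using (hφ.expNegS hCS b).smul k

theorem injOn_expNegS (hCS : BddBelow (Set.range CS)) (b : ℝ) :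
    Set.InjOn (expNegS b CS) almostPeriodic := by
  rintro φ ⟨a, hφ⟩ ψ ⟨a', hψ⟩ h
  have hcoeff : (fun w => (Real.exp (-CS (b * w / 3)) : ℂ) * a w) =
      fun w => (Real.exp (-CS (b * w / 3)) : ℂ) * a' w := by
    rw [← (hφ.expNegS hCS b).bohrCoeff_eq, h, (hψ.expNegS hCS b).bohrCoeff_eq]
  obtain rfl : a = a' := funext fun w =>
    mul_left_cancel₀ (Complex.ofReal_ne_zero.2 (Real.exp_pos _).ne') (congrFun hcoeff w)
  exact hφ.eq_of_coeff_eq hψ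

end expNegS

/-! ### Invariant fields -/

/-- The field `δ^i_a`, which spans the invariant fields. -/
def deltaField : SmoothField ℝ :=
  ⟨fun _ i a => if i = a then 1 else 0,
    (contDiff_const : ContDiff ℝ ∞ fun _ : Space => fun i a : Fin 3 =>
      if i = a then (1 : ℝ) else 0)⟩

theorem smul_deltaField_apply (k : ℝ) (x : Space) (i a : Fin 3) :
    (k • deltaField).1 x i a = if i = a then k else 0 := by
  simp [deltaField]

theorem isSymmetric_smul_deltaField (k : ℝ) : IsSymmetric (k • deltaField) := by
  intro v r
  funext y i a
  have hr : (r.1 * r.1.transpose) i a = (1 : Matrix (Fin 3) (Fin 3) ℝ) i a := by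
    rw [(Matrix.mem_orthogonalGroup_iff (Fin 3) ℝ).1
      (Matrix.mem_specialOrthogonalGroup_iff.1 r.2).1]
  rw [Matrix.mul_apply, Matrix.one_apply] at hr
  simp only [euclAct, smul_deltaField_apply, mul_ite, mul_zero, Finset.sum_ite_eq,
    Finset.mem_univ, if_true, ← Finset.sum_mul]
  simp only [Matrix.transpose_apply] at hr
  rw [hr, ite_mul, one_mul, zero_mul]

section IsSymmetric

variable {X : SmoothField ℝ}

theorem IsSymmetric.apply_eq_apply_zero (hX : IsSymmetric X) (x : Space) : X.1 x = X.1 0 := by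
  funext i a
  have h := congrFun (congrFun (congrFun (hX x 1) x) i) a
  simpa [euclAct, Matrix.one_apply] using h.symm

theorem IsSymmetric.sum_rotation (hX : IsSymmetric X) {r : Matrix (Fin 3) (Fin 3) ℝ}
    (hr : r * r.transpose = 1) (hdet : r.det = 1) (i a : Fin 3) :
    ∑ j, ∑ b, r i j * r a b * X.1 0 j b = X.1 0 i a := by
  have hmem : r ∈ Matrix.specialOrthogonalGroup (Fin 3) ℝ :=
    Matrix.mem_specialOrthogonalGroup_iff.2
      ⟨(Matrix.mem_orthogonalGroup_iff (Fin 3) ℝ).2 hr, hdet⟩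
  simpa [euclAct] using congrFun (congrFun (congrFun (hX 0 ⟨r, hmem⟩) 0) i) a

-- Half turns about two coordinate axes kill the off-diagonal entries, and the cyclic permutation
-- of the axes makes the diagonal ones equal.
theorem IsSymmetric.apply_zero (hX : IsSymmetric X) (i a : Fin 3) :
    X.1 0 i a = if i = a then X.1 0 0 0 else 0 := by
  have halfTurn₁ := hX.sum_rotation (r := !![1, 0, 0; 0, -1, 0; 0, 0, -1])
    (by ext i j; fin_cases i <;> fin_cases j <;> simp [Matrix.mul_apply, Fin.sum_univ_three])
    (by simp [Matrix.det_fin_three])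
  have halfTurn₃ := hX.sum_rotation (r := !![-1, 0, 0; 0, -1, 0; 0, 0, 1])
    (by ext i j; fin_cases i <;> fin_cases j <;> simp [Matrix.mul_apply, Fin.sum_univ_three])
    (by simp [Matrix.det_fin_three])
  have cyclic := hX.sum_rotation (r := !![0, 0, 1; 1, 0, 0; 0, 1, 0])
    (by ext i j; fin_cases i <;> fin_cases j <;> simp [Matrix.mul_apply, Fin.sum_univ_three])
    (by simp [Matrix.det_fin_three])
  have h₁ := halfTurn₁ i a
  have h₃ := halfTurn₃ i a
  have hc := cyclic i a
  have hc₁ := cyclic 1 1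
  fin_cases i <;> fin_cases a <;> simp [Fin.sum_univ_three] at h₁ h₃ hc hc₁ ⊢ <;> linarith

end IsSymmetric

theorem isSymmetric_iff_exists_eq_smul_deltaField {X : SmoothField ℝ} :
    IsSymmetric X ↔ ∃ k : ℝ, X = k • deltaField := by
  refine ⟨fun hX => ⟨X.1 0 0 0, ?_⟩, fun ⟨k, hk⟩ => hk ▸ isSymmetric_smul_deltaField k⟩
  ext x i a
  rw [hX.apply_eq_apply_zero, hX.apply_zero, smul_deltaField_apply]

theorem IsSymmetric.smul {X : SmoothField ℝ} (hX : IsSymmetric X) (c : ℝ) :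
    IsSymmetric (c • X) := by
  obtain ⟨k, rfl⟩ := isSymmetric_iff_exists_eq_smul_deltaField.1 hX
  rw [smul_smul]
  exact isSymmetric_smul_deltaField _

theorem isSymmetric_zero : IsSymmetric (0 : SmoothField ℝ) := by
  simpa only [zero_smul] using isSymmetric_smul_deltaField 0

theorem toC_smul (c : ℝ) (X : SmoothField ℝ) : toC (c • X) = (c : ℂ) • toC X := by
  ext x i a
  simp [toC]

/-! ### Uniqueness of parallel transport -/

theorem continuous_pullback (Z : ConnC) (e : Edge) : Continuous (pullback Z e) := by
  have hparam : Continuous e.param := by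
    unfold Edge.param
    fun_prop
  have hZ : Continuous Z.1 := ContDiff.continuous (𝕜 := ℝ) (n := ∞) Z.2
  unfold pullback
  fun_prop

open scoped Matrix.Norms.Operator in
theorem IsTransport.apply_one_eq {Z : ConnC} {e : Edge} {h h' : ℝ → Matrix (Fin 2) (Fin 2) ℂ}
    (hh : IsTransport Z e h) (hh' : IsTransport Z e h') : h 1 = h' 1 := by
  obtain ⟨K, hK⟩ := isCompact_Icc.exists_bound_of_continuousOn (s := Set.Icc (0 : ℝ) 1)
    (continuous_pullback Z e).continuousOn
  have hderiv {g : ℝ → Matrix (Fin 2) (Fin 2) ℂ} (hg : IsTransport Z e g) (t : ℝ) :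
      HasDerivAt g (pullback Z e t * g t) t :=
    hasDerivAt_pi.2 fun j => hasDerivAt_pi.2 fun k => hg.2 t j k
  have hlip : ∀ t ∈ Set.Ico (0 : ℝ) 1, LipschitzOnWith K.toNNReal
      (fun g => pullback Z e t * g) Set.univ := fun t ht =>
    (LipschitzWith.of_dist_le_mul fun g g' => by
      rw [dist_eq_norm, dist_eq_norm, ← mul_sub]
      refine (norm_mul_le _ _).trans ?_
      gcongr
      exact (hK t (Set.Ico_subset_Icc_self ht)).trans (Real.le_coe_toNNReal K)).lipschitzOnWith
  exact ODE_solution_unique_of_mem_Icc_right hlip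
    (fun t _ => (hderiv hh t).continuousAt.continuousWithinAt)
    (fun t _ => (hderiv hh t).hasDerivWithinAt) (fun _ _ => Set.mem_univ _)
    (fun t _ => (hderiv hh' t).continuousAt.continuousWithinAt)
    (fun t _ => (hderiv hh' t).hasDerivWithinAt) (fun _ _ => Set.mem_univ _)
    (hh.1.trans hh'.1.symm) (Set.right_mem_Icc.2 zero_le_one)

theorem hol_eq_of_isTransport {Z : ConnC} {e : Edge} {h : ℝ → Matrix (Fin 2) (Fin 2) ℂ}
    (hh : IsTransport Z e h) : hol Z e = h 1 := by
  have hex : ∃ h, IsTransport Z e h := ⟨h, hh⟩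
  rw [hol, dif_pos hex]
  exact hex.choose_spec.apply_one_eq hh

/-! ### Holonomies along the invariant connections -/

/-- The element `u^i τ_i` of `su(2)`. -/
def suGen (u : Space) : Matrix (Fin 2) (Fin 2) ℂ := ∑ i, (u i : ℂ) • tau i

theorem suGen_eq (u : Space) : suGen u =
    !![-(Complex.I / 2) * u 2, -(Complex.I / 2) * (u 0 - Complex.I * u 1);
      -(Complex.I / 2) * (u 0 + Complex.I * u 1), Complex.I / 2 * u 2] := by
  ext i j
  fin_cases i <;> fin_cases j <;> simp [suGen, tau, Fin.sum_univ_three] <;> ring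

theorem suGen_smul (k : ℝ) (u : Space) : suGen (k • u) = (k : ℂ) • suGen u := by
  simp only [suGen, Finset.smul_sum, smul_smul, Pi.smul_apply, smul_eq_mul, Complex.ofReal_mul]

theorem star_suGen (u : Space) : star (suGen u) = -suGen u := by
  rw [suGen_eq]
  ext i j
  fin_cases i <;> fin_cases j <;> simp [Matrix.star_apply] <;> ring

theorem suGen_mul_self (u : Space) :
    suGen u * suGen u = (-(∑ i, (u i : ℂ) ^ 2) / 4) • (1 : Matrix (Fin 2) (Fin 2) ℂ) := by
  have hdiag : -(Complex.I / 2) * u 2 * (-(Complex.I / 2) * u 2) + -(Complex.I / 2) *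
      (u 0 - Complex.I * u 1) * (-(Complex.I / 2) * (u 0 + Complex.I * u 1)) =
      -((u 0 : ℂ) ^ 2 + (u 1 : ℂ) ^ 2 + (u 2 : ℂ) ^ 2) / 4 := by
    linear_combination ((u 0 : ℂ) ^ 2 + (u 1 : ℂ) ^ 2 * (1 - Complex.I ^ 2) + (u 2 : ℂ) ^ 2) / 4 *
      Complex.I_sq
  rw [suGen_eq, Matrix.mul_fin_two, Matrix.one_fin_two, Fin.sum_univ_three, ← hdiag,
    Matrix.smul_of, Matrix.smul_cons, Matrix.smul_cons]
  congr 1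
  ext i j
  fin_cases i <;> fin_cases j <;> simp <;> ring

theorem det_smul_one_add_smul_suGen (C S : ℂ) (u : Space) :
    (C • (1 : Matrix (Fin 2) (Fin 2) ℂ) + S • suGen u).det =
      C ^ 2 + S ^ 2 * ((∑ i, (u i : ℂ) ^ 2) / 4) := by
  rw [suGen_eq, Matrix.det_fin_two, Fin.sum_univ_three]
  simp only [Matrix.add_apply, Matrix.smul_apply, Matrix.one_apply_eq, Matrix.of_apply,
    Matrix.cons_val', Matrix.cons_val_zero, Matrix.cons_val_one, Matrix.cons_val_fin_one,
    smul_eq_mul, mul_one, ne_eq, zero_ne_one, one_ne_zero, not_false_eq_true,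
    Matrix.one_apply_ne, mul_zero, zero_add]
  linear_combination (-S ^ 2 * ((u 0 : ℂ) ^ 2 + (u 1 : ℂ) ^ 2 * (1 - Complex.I ^ 2)
    + (u 2 : ℂ) ^ 2) / 4) * Complex.I_sq

namespace Edge

variable (e : Edge)

/-- Half the length of an edge, the frequency of its holonomies along the line of invariant
connections. -/
def freq : ℝ := √(∑ i, (e.tgt i - e.src i) ^ 2) / 2

/-- The direction `u^i τ_i` of an edge in `su(2)`, normalized to have square `-1`. -/
def gen : Matrix (Fin 2) (Fin 2) ℂ := suGen (e.freq⁻¹ • (e.tgt - e.src))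

/-- The matrix `C + S u^i τ_i`, where `u^i τ_i` is the normalized direction of the edge; for
`C = cos θ` and `S = sin θ` it is `exp (θ u^i τ_i)`. -/
def rot (C S : ℂ) : Matrix (Fin 2) (Fin 2) ℂ := C • 1 + S • e.gen

theorem four_mul_freq_sq : 4 * e.freq ^ 2 = ∑ i, (e.tgt i - e.src i) ^ 2 := by
  rw [freq, div_pow, Real.sq_sqrt (by positivity)]
  ring

theorem freq_ne_zero : e.freq ≠ 0 := by
  intro h
  have hsum : ∑ i, (e.tgt i - e.src i) ^ 2 = 0 := by
    rw [← four_mul_freq_sq, h]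
    norm_num
  refine e.ne (funext fun i => ?_)
  have hi := (Finset.sum_eq_zero_iff_of_nonneg fun i _ => sq_nonneg _).1 hsum i (Finset.mem_univ i)
  exact (sub_eq_zero.1 (pow_eq_zero_iff two_ne_zero |>.1 hi)).symm

theorem freq_smul_gen : (e.freq : ℂ) • e.gen = suGen (e.tgt - e.src) := by
  rw [gen, ← suGen_smul, smul_inv_smul₀ e.freq_ne_zero]

theorem sum_sq_direction : ∑ i, (((e.freq⁻¹ • (e.tgt - e.src)) i : ℝ) : ℂ) ^ 2 = 4 := by
  have h : ∑ i, ((e.freq⁻¹ • (e.tgt - e.src)) i) ^ 2 = 4 := by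
    have hfreq := e.freq_ne_zero
    simp only [Pi.smul_apply, Pi.sub_apply, smul_eq_mul, mul_pow]
    rw [← Finset.mul_sum, ← four_mul_freq_sq]
    field_simp
  exact_mod_cast h

theorem gen_mul_gen : e.gen * e.gen = -1 := by
  rw [gen, suGen_mul_self, sum_sq_direction, neg_div, div_self (by norm_num), neg_one_smul]

theorem det_rot (C S : ℂ) : (e.rot C S).det = C ^ 2 + S ^ 2 := by
  rw [rot, gen, det_smul_one_add_smul_suGen, sum_sq_direction, div_self (by norm_num), mul_one]

theorem gen_mul_rot (C S : ℂ) : e.gen * e.rot C S = e.rot (-S) C := by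
  rw [rot, rot, mul_add, mul_smul_comm, mul_smul_comm, gen_mul_gen, mul_one, smul_neg, neg_smul,
    add_comm]

theorem rot_mem_specialUnitaryGroup {C S : ℝ} (h : C ^ 2 + S ^ 2 = 1) :
    e.rot C S ∈ Matrix.specialUnitaryGroup (Fin 2) ℂ := by
  have hCS : (C : ℂ) * C + S * S = 1 := by
    rw [← sq, ← sq]
    exact_mod_cast h
  have hstar : star (e.rot C S) = (C : ℂ) • 1 - (S : ℂ) • e.gen := by
    simp only [rot, gen, star_add, star_smul, star_one, star_suGen, Complex.star_def,
      Complex.conj_ofReal, smul_neg, sub_eq_add_neg]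
  refine Matrix.mem_specialUnitaryGroup_iff.2 ⟨Matrix.mem_unitaryGroup_iff'.2 ?_, ?_⟩
  · rw [hstar, sub_mul, smul_mul_assoc, smul_mul_assoc, one_mul, gen_mul_rot, rot, rot,
      smul_add, smul_add, smul_smul, smul_smul, smul_smul, smul_smul, mul_comm (C : ℂ) S,
      add_sub_add_right_eq_sub, ← sub_smul, mul_neg, sub_neg_eq_add, hCS, one_smul]
  · rw [det_rot, sq, sq, hCS]

theorem pullback_smul_toC_deltaField (z : ℂ) (t : ℝ) :
    pullback (z • toC deltaField) e t = (z * e.freq) • e.gen := by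
  rw [mul_smul, freq_smul_gen, suGen, Finset.smul_sum]
  refine Finset.sum_congr rfl fun i _ => ?_
  rw [Finset.sum_eq_single i]
  · simp [toC, deltaField, smul_smul]
  · intro a _ hai
    simp [toC, deltaField, hai.symm]
  · simp

theorem isTransport_smul_toC_deltaField (z : ℂ) :
    IsTransport (z • toC deltaField) e fun t =>
      e.rot (Complex.cos (e.freq * z * t)) (Complex.sin (e.freq * z * t)) := by
  refine ⟨by simp [rot], fun t j k => ?_⟩
  have hlin : HasDerivAt (fun t : ℂ => e.freq * z * t) (e.freq * z) (t : ℂ) := by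
    simpa only [mul_one, id_eq] using (hasDerivAt_id (t : ℂ)).const_mul (e.freq * z)
  have hrot := (hlin.ccos.comp_ofReal.mul_const ((1 : Matrix (Fin 2) (Fin 2) ℂ) j k)).add
    (hlin.csin.comp_ofReal.mul_const (e.gen j k))
  rw [pullback_smul_toC_deltaField, smul_mul_assoc, gen_mul_rot]
  refine hrot.congr_deriv ?_
  simp only [rot, Matrix.add_apply, Matrix.smul_apply, smul_eq_mul]
  ring

theorem hol_smul_toC_deltaField (z : ℂ) :
    hol (z • toC deltaField) e =
      e.rot (Complex.cos (e.freq * z)) (Complex.sin (e.freq * z)) := by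
  rw [hol_eq_of_isTransport (e.isTransport_smul_toC_deltaField z), Complex.ofReal_one, mul_one]

end Edge

variable {A₀ : Conn}

theorem IsHolCyl.differentiable_smul_toC (hA₀ : IsSymmetric A₀) {Ψ : ConnC → ℂ}
    (hΨ : IsHolCyl Ψ) : Differentiable ℂ fun z : ℂ => Ψ (z • toC A₀) := by
  obtain ⟨k, rfl⟩ := isSymmetric_iff_exists_eq_smul_deltaField.1 hA₀
  obtain ⟨n, e, F, hF, hΨF⟩ := hΨ
  simp only [toC_smul, smul_smul, hΨF, Edge.hol_smul_toC_deltaField]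
  intro z
  refine DifferentiableAt.comp (F := Tuple n) z (hF _ fun j => ?_).differentiableAt ?_
  · exact ((e j).det_rot _ _).trans (Complex.cos_sq_add_sin_sq _)
  · refine differentiableAt_pi (F' := fun _ => Fin 2 → Fin 2 → ℂ) |>.2 fun j =>
      differentiableAt_pi.2 fun a => differentiableAt_pi.2 fun c => ?_
    simp only [Edge.rot, Matrix.add_apply, Matrix.smul_apply, smul_eq_mul]
    fun_prop

/-! ### Reduced cylindrical functions are almost periodic -/

/-- The function on the torus which `F`, evaluated on one-parameter groups generated by the edges
`e`, induces: the angle of the `j`-th rotation is `2π θ_j`. -/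
def cylTorus {n : ℕ} (e : Fin n → Edge) (F : Tuple n → ℂ) (θ : UnitAddTorus (Fin n)) : ℂ :=
  F fun j => (e j).rot ((fourier 1 (θ j) : ℂ).re : ℂ) ((fourier 1 (θ j) : ℂ).im : ℂ)

theorem cylTorus_proj {n : ℕ} (e : Fin n → Edge) (F : Tuple n → ℂ) (x : Fin n → ℝ) :
    cylTorus e F (TorusFourier.proj x) = F fun j =>
      (e j).rot (Real.cos (2 * Real.pi * x j) : ℝ) (Real.sin (2 * Real.pi * x j) : ℝ) := by
  have hfourier (y : ℝ) : (fourier 1 (y : UnitAddCircle) : ℂ) =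
      Complex.exp (((2 * Real.pi * y : ℝ) : ℂ) * Complex.I) := by
    rw [fourier_coe_apply]
    congr 1
    push_cast
    ring
  simp only [cylTorus, TorusFourier.proj, hfourier, Complex.exp_ofReal_mul_I_re,
    Complex.exp_ofReal_mul_I_im]

theorem isSmooth_cylTorus {n : ℕ} (e : Fin n → Edge) {F : Tuple n → ℂ}
    (hF : AnalyticOnNhd ℝ F (SUn n)) : TorusFourier.IsSmooth (cylTorus e F) := by
  unfold TorusFourier.IsSmooth
  simp only [cylTorus_proj]
  refine contDiff_iff_contDiffAt.2 fun x => ?_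
  refine ContDiffAt.comp (F := Tuple n) x (hF _ fun j => ?_).contDiffAt ?_
  · exact (e j).rot_mem_specialUnitaryGroup (Real.cos_sq_add_sin_sq _)
  · refine contDiffAt_pi (F' := fun _ => Fin 2 → Fin 2 → ℂ) |>.2 fun j =>
      contDiffAt_pi.2 fun a => contDiffAt_pi.2 fun c => ?_
    have hangle : ContDiffAt ℝ ∞ (fun x : Fin n → ℝ => 2 * Real.pi * x j) x := by fun_prop
    have hcos := Complex.ofRealCLM.contDiff.contDiffAt.comp x hangle.cos
    have hsin := Complex.ofRealCLM.contDiff.contDiffAt.comp x hangle.sin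
    exact (hcos.mul contDiffAt_const).add (hsin.mul contDiffAt_const)

theorem cylS_le_almostPeriodic (hA₀ : IsSymmetric A₀) : CylS A₀ ≤ almostPeriodic := by
  rintro _ ⟨Φ, ⟨n, e, F, hF, hΦ⟩, rfl⟩
  obtain ⟨k, rfl⟩ := isSymmetric_iff_exists_eq_smul_deltaField.1 hA₀
  have hline : LinearMap.funLeft ℂ ℂ (rMap (k • deltaField)) Φ = fun c : ℝ =>
      cylTorus e F (TorusFourier.proj (c • fun j => k * (e j).freq / (2 * Real.pi))) := by
    funext c
    rw [LinearMap.funLeft_apply, hΦ, cylTorus_proj]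
    congr 1
    funext j
    have hangle : 2 * Real.pi * (c • fun j => k * (e j).freq / (2 * Real.pi)) j =
        (e j).freq * (c * k) := by
      rw [Pi.smul_apply, smul_eq_mul]
      field_simp
    rw [rMap, smul_smul, toC_smul, Edge.hol_smul_toC_deltaField, hangle]
    push_cast
    rfl
  rw [hline]
  exact comp_line_mem_almostPeriodic (isSmooth_cylTorus e hF) _

/-! ### The holomorphic transforms -/

theorem eq_of_forall_ofReal_eq {f g : ℂ → ℂ} (hf : Differentiable ℂ f) (hg : Differentiable ℂ g)
    (hfg : ∀ c : ℝ, f c = g c) : f = g := by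
  refine AnalyticOnNhd.eq_of_frequently_eq (𝕜 := ℂ) (z₀ := 0)
    (fun z _ => hf.analyticAt z) (fun z _ => hg.analyticAt z) ?_
  have hreal : Tendsto (fun c : ℝ => (c : ℂ)) (𝓝[≠] 0) (𝓝[≠] 0) := by
    refine tendsto_nhdsWithin_iff.2 ⟨?_, ?_⟩
    · exact (Complex.continuous_ofReal.tendsto' 0 0 Complex.ofReal_zero).mono_left
        nhdsWithin_le_nhds
    · filter_upwards [self_mem_nhdsWithin] with c hc
      simpa using hc
  exact hreal.frequently (Eventually.of_forall hfg).frequently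

section HolU

variable {T : StraightCyl →ₗ[ℂ] StraightCyl} {A₀ : Conn}

theorem isContinuation_holU (hU : ∀ Φ : StraightCyl, ∃ Ψ, IsContinuation (T Φ).1 Ψ)
    (Φ : StraightCyl) : IsContinuation (T Φ).1 (holU T Φ) := by
  rw [holU, dif_pos (hU Φ)]
  exact (hU Φ).choose_spec

theorem isLinearMap_holU_smul_toC (hU : ∀ Φ : StraightCyl, ∃ Ψ, IsContinuation (T Φ).1 Ψ)
    (hA₀ : IsSymmetric A₀) : IsLinearMap ℂ fun (Φ : StraightCyl) (z : ℂ) =>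
      holU T Φ (z • toC A₀) := by
  have hdiff (Φ) : Differentiable ℂ fun z : ℂ => holU T Φ (z • toC A₀) :=
    (isContinuation_holU hU Φ).1.differentiable_smul_toC hA₀
  have hreal (Φ) (c : ℝ) : holU T Φ ((c : ℂ) • toC A₀) = (T Φ).1 (c • A₀) := by
    rw [← toC_smul, (isContinuation_holU hU Φ).2]
  constructor
  · intro Φ Φ'
    refine eq_of_forall_ofReal_eq (hdiff _) ((hdiff Φ).add (hdiff Φ')) fun c => ?_
    simp [hreal]
  · intro k Φ
    refine eq_of_forall_ofReal_eq (hdiff _) ((hdiff Φ).const_smul k) fun c => ?_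
    simp [hreal]

end HolU

section HolUS

variable {b : ℝ} {CS : ℝ → ℝ} {V : Submodule ℂ (ℝ → ℂ)}

theorem isEntireExtension_holUS {φ : ℝ → ℂ} (h : ∃ f, IsEntireExtension (expNegS b CS φ) f) :
    IsEntireExtension (expNegS b CS φ) (holUS b CS φ) := by
  rw [holUS, dif_pos h]
  exact h.choose_spec

theorem isLinearMap_holUS (hCS : BddBelow (Set.range CS)) (hV : V ≤ almostPeriodic)
    (hUS : ∀ φ ∈ V, ∃ f, IsEntireExtension (expNegS b CS φ) f) :
    IsLinearMap ℂ fun φ : V => holUS b CS φ := by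
  have hext (φ : V) := isEntireExtension_holUS (hUS φ φ.2)
  constructor
  · intro φ ψ
    refine eq_of_forall_ofReal_eq (hext _).1 ((hext φ).1.add (hext ψ).1) fun c => ?_
    rw [(hext _).2, Pi.add_apply, (hext φ).2, (hext ψ).2, Submodule.coe_add,
      expNegS_add hCS (hV φ.2) (hV ψ.2), Pi.add_apply]
  · intro k φ
    refine eq_of_forall_ofReal_eq (hext _).1 ((hext φ).1.const_smul k) fun c => ?_
    rw [(hext _).2, Pi.smul_apply, (hext φ).2, Submodule.coe_smul, expNegS_smul hCS (hV φ.2),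
      Pi.smul_apply]

theorem injective_holUS (hCS : BddBelow (Set.range CS)) (hV : V ≤ almostPeriodic)
    (hUS : ∀ φ ∈ V, ∃ f, IsEntireExtension (expNegS b CS φ) f) :
    Function.Injective fun φ : V => holUS b CS φ := by
  have hext (φ : V) := isEntireExtension_holUS (hUS φ φ.2)
  intro φ ψ hφψ
  refine Subtype.ext (injOn_expNegS hCS b (hV φ.2) (hV ψ.2) (funext fun c => ?_))
  rw [← (hext φ).2, ← (hext ψ).2, show holUS b CS φ = holUS b CS ψ from hφψ]

end HolUS

/-! ### The inclusion of the symmetric phase space -/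

theorem funcDeriv_eq_zero {C : Complexifier} {E : Triad} (hex : ∃ D, HasFuncDeriv C E D)
    (h : ∀ D, HasFuncDeriv C E D → D = 0) : funcDeriv C E = 0 := by
  rw [funcDeriv, dif_pos hex]
  exact h _ hex.choose_spec

theorem frakZ_zero_momentum {C : Complexifier} (hC : funcDeriv C 0 = 0) (b : ℝ) (A : Conn) :
    frakZ b C (A, 0) = toC A := by
  have htoC : toC (0 : SmoothField ℝ) = 0 := by
    simpa only [zero_smul, Complex.ofReal_zero] using toC_smul 0 (0 : SmoothField ℝ)
  rw [frakZ, hC, htoC, smul_zero, sub_zero]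

theorem refDensTriad_smul_deltaField (ℓ : ℝ) {k : ℝ} (hk : k ≠ 0) (x : Space) (i a : Fin 3) :
    refDensTriad ℓ (k • deltaField) x i a =
      if i = a then |(ℓ⁻¹ * k⁻¹) ^ 3|⁻¹ * (ℓ⁻¹ * k⁻¹) else 0 := by
  have hmat : Matrix.of ((k • deltaField).1 x) = k • (1 : Matrix (Fin 3) (Fin 3) ℝ) := by
    ext j b
    rw [Matrix.of_apply, smul_deltaField_apply, Matrix.smul_apply, Matrix.one_apply, smul_eq_mul,
      mul_ite, mul_one, mul_zero]
  have hinv : (Matrix.of ((k • deltaField).1 x))⁻¹ = k⁻¹ • (1 : Matrix (Fin 3) (Fin 3) ℝ) := by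
    refine Matrix.inv_eq_right_inv ?_
    rw [hmat, smul_mul_smul_comm, mul_inv_cancel₀ hk, one_smul, one_mul]
  simp only [refDensTriad, refTriad, hinv, smul_smul, Matrix.det_smul, Matrix.det_one, mul_one,
    Fintype.card_fin, Matrix.smul_apply, Matrix.one_apply, smul_eq_mul, eq_comm (a := a),
    mul_ite, mul_zero]

section Inclusion

variable {b ℓ : ℝ} {A₀ : Conn} {C : Complexifier} {CS : ℝ → ℝ} {s : ℂ → ConnC}

theorem exists_hasCoords (hℓ : ℓ ≠ 0) (hA₀ : IsSymmetric A₀) (hA₀' : A₀ ≠ 0) {ξ : Conn × Triad}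
    (hξ : ξ ∈ symPhase) : ∃ c p, HasCoords ℓ A₀ ξ c p := by
  obtain ⟨k, rfl⟩ := isSymmetric_iff_exists_eq_smul_deltaField.1 hA₀
  obtain ⟨kA, hkA⟩ := isSymmetric_iff_exists_eq_smul_deltaField.1 hξ.1
  obtain ⟨kE, hkE⟩ := isSymmetric_iff_exists_eq_smul_deltaField.1 hξ.2
  have hk : k ≠ 0 := (smul_ne_zero_iff.1 hA₀').1
  have hr : ℓ⁻¹ * k⁻¹ ≠ 0 := mul_ne_zero (inv_ne_zero hℓ) (inv_ne_zero hk)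
  have hq : |(ℓ⁻¹ * k⁻¹) ^ 3|⁻¹ * (ℓ⁻¹ * k⁻¹) ≠ 0 :=
    mul_ne_zero (inv_ne_zero (abs_ne_zero.2 (pow_ne_zero 3 hr))) hr
  refine ⟨kA / k, kE * ℓ ^ 2 / (|(ℓ⁻¹ * k⁻¹) ^ 3|⁻¹ * (ℓ⁻¹ * k⁻¹)), ?_, fun x i a => ?_⟩
  · rw [hkA, smul_smul, div_mul_cancel₀ _ hk]
  · rw [hkE, refDensTriad_smul_deltaField ℓ hk, smul_deltaField_apply]
    generalize |(ℓ⁻¹ * k⁻¹) ^ 3|⁻¹ * (ℓ⁻¹ * k⁻¹) = q at hq ⊢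
    split_ifs
    · field_simp
    · rw [mul_zero]

theorem IsHolInclusion.apply_ofReal (hs : IsHolInclusion b ℓ A₀ C CS s) (hA₀ : IsSymmetric A₀)
    (hCS : deriv CS 0 = 0) (c : ℝ) : s c = frakZ b C (c • A₀, 0) := by
  have h := hs.1 (c • A₀, 0) ⟨hA₀.smul c, isSymmetric_zero⟩ c 0 ⟨rfl, by simp⟩
  rwa [redZ, hCS, mul_zero, Complex.ofReal_zero, mul_zero, sub_zero] at h

theorem IsHolInclusion.eq_smul_toC (hs : IsHolInclusion b ℓ A₀ C CS s) (hA₀ : IsSymmetric A₀)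
    (hC : funcDeriv C 0 = 0) (hCS : deriv CS 0 = 0) : s = fun z => z • toC A₀ := by
  funext z
  ext x i a
  refine congrFun (eq_of_forall_ofReal_eq (hs.2 x i a) (g := fun z => (z • toC A₀).1 x i a) ?_
    fun c => ?_) z
  · simp only [Submodule.coe_smul, Pi.smul_apply, smul_eq_mul]
    fun_prop
  · rw [hs.apply_ofReal hA₀ hCS, frakZ_zero_momentum hC, toC_smul]

theorem IsHolInclusion.exists_eq_frakZ (hs : IsHolInclusion b ℓ A₀ C CS s) (hℓ : ℓ ≠ 0)
    (hA₀ : IsSymmetric A₀) (hA₀' : A₀ ≠ 0) {ξ : Conn × Triad} (hξ : ξ ∈ symPhase) :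
    ∃ z, s z = frakZ b C ξ :=
  let ⟨c, p, hcp⟩ := exists_hasCoords hℓ hA₀ hA₀' hξ
  ⟨redZ b CS c p, hs.1 ξ hξ c p hcp⟩

theorem IsHolInclusion.comp_eq_zero_iff (hs : IsHolInclusion b ℓ A₀ C CS s) (hℓ : ℓ ≠ 0)
    (hA₀ : IsSymmetric A₀) (hA₀' : A₀ ≠ 0) (hCS : deriv CS 0 = 0) {Ψ : ConnC → ℂ}
    (hΨ : Differentiable ℂ fun z => Ψ (s z)) :
    (fun z => Ψ (s z)) = 0 ↔ ∀ ξ ∈ symPhase, Ψ (frakZ b C ξ) = 0 := by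
  refine ⟨fun h ξ hξ => ?_, fun h => ?_⟩
  · obtain ⟨z, hz⟩ := hs.exists_eq_frakZ hℓ hA₀ hA₀' hξ
    rw [← hz]
    exact congrFun h z
  · refine eq_of_forall_ofReal_eq hΨ (differentiable_const 0) fun c => ?_
    rw [hs.apply_ofReal hA₀ hCS]
    exact h _ ⟨hA₀.smul c, isSymmetric_zero⟩

end Inclusion

/-! ### The projection and the b-embedding -/

section Linear

variable {R U V W : Type*} [Semiring R] [AddCommMonoid V] [AddCommMonoid W] [Module R V]
  [Module R W] {L : V → W} {M : U → W} {P : U → V}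

theorem apply_eq_zero_iff_of_comp_eq (hL : IsLinearMap R L) (hinj : Function.Injective L)
    (hLP : ∀ u, L (P u) = M u) (u : U) : P u = 0 ↔ M u = 0 := by
  rw [← hLP, ← (hL.mk' L).map_zero]
  exact hinj.eq_iff.symm

variable [AddCommMonoid U] [Module R U]

theorem isLinearMap_of_comp_eq (hL : IsLinearMap R L) (hinj : Function.Injective L)
    (hM : IsLinearMap R M) (hLP : ∀ u, L (P u) = M u) : IsLinearMap R P where
  map_add u v := hinj (by rw [hL.map_add, hLP, hLP, hLP, hM.map_add])
  map_smul k u := hinj (by rw [hL.map_smul, hLP, hLP, hM.map_smul])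

end Linear

theorem mem_range_iotaB {A₀ : Conn} {P : StraightCyl → CylS A₀} (hP : IsLinearMap ℂ P)
    {Ψ : Module.Dual ℂ StraightCyl} :
    Ψ ∈ Set.range (iotaB hP) ↔ ∀ Φ, P Φ = 0 → Ψ Φ = 0 := by
  rw [← LinearMap.coe_range, iotaB, LinearMap.range_dualMap_eq_dualAnnihilator_ker,
    SetLike.mem_coe, Submodule.mem_dualAnnihilator]
  rfl

theorem holUS_piMap {b : ℝ} {A₀ : Conn} {CS : ℝ → ℝ} {T : StraightCyl →ₗ[ℂ] StraightCyl}
    {s : ℂ → ConnC}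
    (hπ : ∀ Φ : StraightCyl, ∃ φ ∈ CylS A₀, holUS b CS φ = fun z => holU T Φ (s z))
    (Φ : StraightCyl) :
    holUS b CS (piMap b A₀ CS T s Φ) = fun z => holU T Φ (s z) := by
  have hex : ∃ φ : CylS A₀, holUS b CS φ.1 = fun z => holU T Φ (s z) :=
    let ⟨φ, hφ, h⟩ := hπ Φ
    ⟨⟨φ, hφ⟩, h⟩
  rw [piMap, dif_pos hex]
  exact hex.choose_spec

end BEmbedding

end

open BEmbedding in
theorem mainTheorem4_general
    (b ℓ : ℝ) (hℓ : ℓ ≠ 0) (A₀ : Conn) (hA₀ : IsSymmetric A₀) (hA₀' : A₀ ≠ 0)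
    (C : Complexifier) (hCdiff : ∀ E : Triad, IsSymmetric E → ∃ D, HasFuncDeriv C E D)
    (hC0 : ∀ D, HasFuncDeriv C 0 D → D = 0)
    (CS CS' : ℝ → ℝ) (hCSbdd : BddBelow (Set.range CS)) (hCSderiv : ∀ p, HasDerivAt CS (CS' p) p)
    (hCS0 : CS' 0 = 0)
    (T : StraightCyl →ₗ[ℂ] StraightCyl)
    (hU : ∀ Φ : StraightCyl, ∃ Ψ, IsContinuation (T Φ).1 Ψ)
    (hUS : ∀ φ ∈ CylS A₀, ∃ f, IsEntireExtension (expNegS b CS φ) f)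
    (s : ℂ → ConnC) (hs : IsHolInclusion b ℓ A₀ C CS s)
    (hπ : ∀ Φ : StraightCyl, ∃ φ ∈ CylS A₀, holUS b CS φ = fun z => holU T Φ (s z)) :
    (∀ ξ ∈ symPhase, IsLinearMap ℂ (coherentState T (frakZ b C ξ))) ∧
    ∃ hlin : IsLinearMap ℂ (piMap b A₀ CS T s),
      Set.range (iotaB hlin) =
        {Ψ : Module.Dual ℂ StraightCyl |
          ∀ Φ : StraightCyl, (∀ Z ∈ frakZ b C '' symPhase, holU T Φ Z = 0) → Ψ Φ = 0} ∧
      Set.range (iotaB hlin) =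
        {Ψ : Module.Dual ℂ StraightCyl |
          ∀ Φ : StraightCyl, (∀ ξ ∈ symPhase, coherentState T (frakZ b C ξ) Φ = 0) →
            Ψ Φ = 0} := by
  have hderiv : deriv CS 0 = 0 := (hCSderiv 0).deriv.trans hCS0
  have hs_line : s = fun z => z • toC A₀ :=
    hs.eq_smul_toC hA₀ (funcDeriv_eq_zero (hCdiff 0 isSymmetric_zero) hC0) hderiv
  have hUlin : IsLinearMap ℂ fun (Φ : StraightCyl) z => holU T Φ (s z) :=
    hs_line ▸ isLinearMap_holU_smul_toC hU hA₀
  have hUdiff (Φ) : Differentiable ℂ fun z => holU T Φ (s z) :=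
    hs_line ▸ (isContinuation_holU hU Φ).1.differentiable_smul_toC hA₀
  have hUSlin := isLinearMap_holUS hCSbdd (cylS_le_almostPeriodic hA₀) hUS
  have hUSinj := injective_holUS hCSbdd (cylS_le_almostPeriodic hA₀) hUS
  have hπlin := isLinearMap_of_comp_eq hUSlin hUSinj hUlin (holUS_piMap hπ)
  have hker (Φ) : piMap b A₀ CS T s Φ = 0 ↔
      ∀ ξ ∈ symPhase, coherentState T (frakZ b C ξ) Φ = 0 :=
    (apply_eq_zero_iff_of_comp_eq hUSlin hUSinj (holUS_piMap hπ) Φ).trans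
      (hs.comp_eq_zero_iff hℓ hA₀ hA₀' hderiv (hUdiff Φ))
  have hrange : Set.range (iotaB hπlin) = {Ψ | ∀ Φ : StraightCyl,
      (∀ ξ ∈ symPhase, coherentState T (frakZ b C ξ) Φ = 0) → Ψ Φ = 0} :=
    Set.ext fun Ψ => (mem_range_iotaB hπlin).trans (forall_congr' fun Φ => imp_congr_left (hker Φ))
  refine ⟨fun ξ hξ => ?_, hπlin, ?_, hrange⟩
  · obtain ⟨z, hz⟩ := hs.exists_eq_frakZ hℓ hA₀ hA₀' hξ
    exact hz ▸ ⟨fun Φ Φ' => congrFun (hUlin.map_add Φ Φ') z,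
      fun k Φ => congrFun (hUlin.map_smul k Φ) z⟩
  · simpa only [Set.forall_mem_image, coherentState] using hrange

open BEmbedding in
theorem mainTheorem4
    -- Newton's constant, the Barbero-Immirzi parameter, and `b = 8πGγ`
    (G γ b : ℝ) (hG : 0 < G) (hγ : 0 < γ) (hb : b = 8 * Real.pi * G * γ)
    -- the reference length and the symmetric reference connection
    (ℓ : ℝ) (hℓ : 0 < ℓ) (A₀ : Conn) (hA₀ : IsSymmetric A₀) (hA₀' : A₀ ≠ 0)
    -- the classical complexifiers, both functions of the momenta only, with derivatives that
    -- vanish only at zero momentum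
    (C : Complexifier) (CS : ℝ → ℝ)
    (hCdiff : ∀ E : Triad, IsSymmetric E → ∃ D, HasFuncDeriv C E D)
    (hC0 : ∀ E D, HasFuncDeriv C E D → (D = 0 ↔ E = 0))
    (hCSnonneg : ∀ p, 0 ≤ CS p) (hCSdiff : Differentiable ℝ CS)
    (hCS0 : ∀ p, deriv CS p = 0 ↔ p = 0)
    -- the quantum complexifier, and `T`, the action of `e^{-Ĉ}` on straight-edge Cyl
    (Chat : KinHilbert →ₗ.[ℂ] KinHilbert) (hChat : IsNonnegSelfAdjoint Chat)
    (T : StraightCyl →ₗ[ℂ] StraightCyl) (hT : IsExpNegOnCyl Chat T)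
    -- the coherent states of both theories exist
    (hU : ∀ Φ : StraightCyl, ∃ Ψ, IsContinuation (T Φ).1 Ψ)
    (hUS : ∀ φ ∈ CylS A₀, ∃ f, IsEntireExtension (expNegS b CS φ) f)
    -- `s` is holomorphic, and `π` is defined on all of straight-edge Cyl
    (s : ℂ → ConnC) (hs : IsHolInclusion b ℓ A₀ C CS s)
    (hπ : ∀ Φ : StraightCyl, ∃ φ ∈ CylS A₀, holUS b CS φ = fun z => holU T Φ (s z)) :
    (∀ ξ ∈ symPhase, IsLinearMap ℂ (coherentState T (frakZ b C ξ))) ∧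
    ∃ hlin : IsLinearMap ℂ (piMap b A₀ CS T s),
      Set.range (iotaB hlin) =
        {Ψ : Module.Dual ℂ StraightCyl |
          ∀ Φ : StraightCyl, (∀ Z ∈ frakZ b C '' symPhase, holU T Φ Z = 0) → Ψ Φ = 0} ∧
      Set.range (iotaB hlin) =
        {Ψ : Module.Dual ℂ StraightCyl |
          ∀ Φ : StraightCyl, (∀ ξ ∈ symPhase, coherentState T (frakZ b C ξ) Φ = 0) →
            Ψ Φ = 0} := by
  exact mainTheorem4_general b ℓ hℓ.ne' A₀ hA₀ hA₀' C hCdiff (fun D hD => (hC0 0 D hD).2 rfl) CS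
    (deriv CS) ⟨0, Set.forall_mem_range.2 hCSnonneg⟩ (fun p => (hCSdiff p).hasDerivAt)
    ((hCS0 0).2 rfl) T hU hUS s hs hπ
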